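/- Let $\mathcal H$ be a separable infinite-dimensional complex Hilbert space, $\mathfrak B(\mathcal H)$ the algebra of bounded operators with operator norm $\|\cdot\|$, $\|\cdot\|_1$ the trace norm, $\mathfrak T(\mathcal H)$ the trace-class operators, $\mathfrak T_{+,1}(\mathcal H)=\{\rho\in\mathfrak T(\mathcal H):\rho\ge 0,\ \mathrm{Tr}\rho\le 1\}$ and $\mathfrak S(\mathcal H)=\{\rho\in\mathfrak T(\mathcal H):\rho\ge 0,\ \mathrm{Tr}\rho=1\}$. Let $G$ be a positive densely defined self-adjoint operator on $\mathcal H$ with $\inf\{\|G\varphi\|:\varphi\in\mathcal D(G),\|\varphi\|=1\}=0$. Put $\langle\varphi|G|\varphi\rangle=\|\sqrt G\varphi\|^2$ if $\varphi\in\mathcal D(\sqrt G)$ and $+\infty$ otherwise, and, for a positive $\rho\in\mathfrak T(\mathcal H)$, $\mathrm{Tr}\,G\rho=\sup_n\mathrm{Tr}\,P_nG\rho\in[0,+\infty]$, where $P_n$ is the spectral projector of $G$ for $[0,n]$. For $E\ge 0$ and $A\in\mathfrak B(\mathcal H)$ let $$\|A\|^G_E=\sup\{\|A\varphi\|:\ \|\varphi\|=1,\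 \langle\varphi|G|\varphi\rangle\le E\}$$ (with the convention $\sup\emptyset=0$, which matters only for $E=0$). Let $E>0$. Then: A) $\|A\|^G_E=\||A|\|^G_E\le\sqrt{\|A^*A\|^G_E}$ for all $A\in\mathfrak B(\mathcal H)$. But $\|A^*\|^G_E\ne\|A\|^G_E$ in general: for every $E>0$ there are such an operator $G$ and an $A\in\mathfrak B(\mathcal H)$ with $\|A^*\|^G_E\neq\|A\|^G_E$. B) For all $A,B\in\mathfrak B(\mathcal H)$, $$m(A)\|B\|^G_E\le\|AB\|^G_E\le\|A\|\,\|B\|^G_E,$$ where $m(A)$ is the infimum of the spectrum of $|A|=\sqrt{A^*A}$. C) If $A,B\in\mathfrak B(\mathcal H)$ satisfy $\langle A\varphi|B\varphi\rangle=0$ for all $\varphi\in\mathcal H$, then $$\max\{\|A\|^G_E,\|B\|^G_E\}\le\|A+B\|^G_E\le\sqrt{[\|A\|^G_E]^2+[\|B\|^G_E]^2}.$$ D) For $\rho\in\mathfrak T_{+,1}(\mathcal H)$ with finite $E_\rho=\mathrm{Tr}\,G\rho$ and all $A,B\in\mathfrak B(\mathcal H)$, the operator $A\rho B^*$ is trace-class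 and $$|\mathrm{Tr}A\rho B^*|\le\|A\rho B^*\|_1\le\|A\|^G_{E_\rho}\|B\|^G_{E_\rho}.$$ E) Let $\Phi:\mathfrak B(\mathcal H)\to\mathfrak B(\mathcal H)$ be a 2-positive linear map with $\Phi(I)\le I$ that has a predual map $\Phi_*:\mathfrak T(\mathcal H)\to\mathfrak T(\mathcal H)$ (that is, $\mathrm{Tr}\,\Phi(A)\rho=\mathrm{Tr}\,A\Phi_*(\rho)$ for all $A\in\mathfrak B(\mathcal H)$ and $\rho\in\mathfrak T(\mathcal H)$) such that $Y_\Phi(E)=\sup\{\mathrm{Tr}\,G\Phi_*(\rho):\rho\in\mathfrak S(\mathcal H),\ \mathrm{Tr}\,G\rho\le E\}$ is finite. Then for all $A\in\mathfrak B(\mathcal H)$ $$\|\Phi(A)\|^G_E\le\sqrt{\|\Phi(I)\|}\,\|A\|^G_{Y_\Phi(E)}\le\sqrt{\|\Phi(I)\|K_\Phi}\,\|A\|^G_E,\qquad K_\Phi=\max\{1,Y_\Phi(E)/E\}.$$ -/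

import Mathlib

namespace OpENorm

section

variable {H : Type*} [NormedAddCommGroup H] [InnerProductSpace ℂ H] [CompleteSpace H]

/-! ### Positive operators, their square roots and spectral projectors -/

/-- `G` is a positive (positive semidefinite, self-adjoint, densely defined, possibly unbounded)
operator on `H`. -/
structure IsPositiveOperator (G : H →ₗ.[ℂ] H) : Prop where
  dense : Dense (G.domain : Set H)
  selfAdjoint : IsSelfAdjoint G
  nonneg : ∀ φ : G.domain, 0 ≤ (inner ℂ (φ : H) (G φ)).re

/-- The condition `inf {‖G φ‖ : φ ∈ D(G), ‖φ‖ = 1} = 0`. -/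
def HasZeroInf (G : H →ₗ.[ℂ] H) : Prop :=
  IsGLB {r : ℝ | ∃ φ : G.domain, ‖(φ : H)‖ = 1 ∧ r = ‖G φ‖} 0

open Classical in
/-- The bounded operator `R = (1 + G)⁻¹`: `R ψ` lies in `D(G)` and `G (R ψ) = ψ - R ψ`. -/
noncomputable def resolvent (G : H →ₗ.[ℂ] H) : H →L[ℂ] H :=
  if h : ∃ T : H →L[ℂ] H, ∀ ψ : H, (T ψ, ψ - T ψ) ∈ G.graph then h.choose else 0

/-- The positive square root `√G = (1 - R)^{1/2} R^{-1/2}`, `R = (1 + G)⁻¹`, on its natural domain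
`D(√G) = ran R^{1/2}`. The theorem `isSqrt_sqrtOp` below shows that it is a positive self-adjoint
operator with `√G √G = G`. -/
noncomputable def sqrtOp (G : H →ₗ.[ℂ] H) : H →ₗ.[ℂ] H :=
  (CFC.sqrt (1 - resolvent G) : H →L[ℂ] H).toLinearMap.compPMap
    ((CFC.sqrt (resolvent G) : H →L[ℂ] H).toLinearMap.toPMap ⊤).inverse

open Classical in
/-- `⟨φ|G|φ⟩ = ‖√G φ‖²` for `φ ∈ D(√G)` and `+∞` otherwise. -/
noncomputable def energy (G : H →ₗ.[ℂ] H) (φ : H) : ENNReal :=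
  if h : φ ∈ (sqrtOp G).domain then ENNReal.ofReal (‖sqrtOp G ⟨φ, h⟩‖ ^ 2) else ⊤

/-- The spectral projector `P_n` of a positive operator `G` for the interval `[0, n]`. In terms of
`R = (1 + G)⁻¹` it is the spectral projector of the bounded operator `R` for `[1 / (n + 1), ∞)`, that
is, the orthogonal projector onto the kernel of the negative part of `R - 1 / (n + 1)`. -/
noncomputable def spectralProj (G : H →ₗ.[ℂ] H) (n : ℕ) : H →L[ℂ] H :=
  (cfc (fun r : ℝ => max (1 / ((n : ℝ) + 1) - r) 0) (resolvent G) : H →L[ℂ] H).ker.starProjection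

open Classical in
/-- The bounded operator `P_n G`, i.e. the everywhere defined operator `φ ↦ G (P_n φ)`. -/
noncomputable def truncOp (G : H →ₗ.[ℂ] H) (n : ℕ) : H →L[ℂ] H :=
  if h : ∃ T : H →L[ℂ] H, ∀ φ : H, (spectralProj G n φ, T φ) ∈ G.graph then h.choose else 0

/-! ### The operators above are well defined -/

theorem resolvent_exists {G : H →ₗ.[ℂ] H} (hG : IsPositiveOperator G) :
    ∃ T : H →L[ℂ] H, ∀ ψ : H, (T ψ, ψ - T ψ) ∈ G.graph := by
  have hcl : IsClosed (G.graph : Set (H × H)) := hG.selfAdjoint.isClosed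
  have hpos : ∀ p ∈ G.graph, 0 ≤ (inner ℂ p.1 p.2).re := by
    intro p hp
    obtain ⟨y, hy⟩ := (LinearPMap.mem_graph_iff' G).1 hp
    rw [← hy]; exact hG.nonneg y
  have hb1 : ∀ p ∈ G.graph, ‖p.1‖ ≤ ‖p.1 + p.2‖ := by
    intro p hp
    have h1 := hpos p hp
    have h2 : ‖p.1 + p.2‖ ^ 2 = ‖p.1‖ ^ 2 + 2 * (inner ℂ p.1 p.2).re + ‖p.2‖ ^ 2 :=
      norm_add_sq (𝕜 := ℂ) p.1 p.2
    nlinarith [norm_nonneg p.1, norm_nonneg (p.1 + p.2), sq_nonneg ‖p.2‖]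
  have hb : ∀ p ∈ G.graph, ‖p‖ ≤ 2 * ‖p.1 + p.2‖ := by
    intro p hp
    have h1 := hb1 p hp
    have h2 : ‖p.2‖ ≤ ‖p.1 + p.2‖ + ‖p.1‖ := by
      have := norm_sub_le (p.1 + p.2) p.1
      simpa using this
    rw [Prod.norm_def]
    exact max_le (by linarith [norm_nonneg (p.1 + p.2)]) (by linarith)
  let L : G.graph →L[ℂ] H :=
    (ContinuousLinearMap.fst ℂ H H + ContinuousLinearMap.snd ℂ H H).comp G.graph.subtypeL
  have hL : ∀ p : G.graph, L p = p.1.1 + p.1.2 := fun p => rfl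
  have hanti : AntilipschitzWith 2 L :=
    AddMonoidHomClass.antilipschitz_of_bound L (fun p => by simpa [hL] using hb p.1 p.2)
  have : CompleteSpace G.graph := hcl.completeSpace_coe
  have hrc : IsClosed (L.range : Set H) := by
    rw [LinearMap.coe_range]
    exact hanti.isClosed_range L.uniformContinuous
  have hperp : L.rangeᗮ = ⊥ := by
    rw [Submodule.eq_bot_iff]
    intro ψ hψ
    have h0 : ∀ x : G.domain, inner ℂ (-ψ) (x : H) = inner ℂ ψ (G x) := by
      intro x
      have := (Submodule.mem_orthogonal' _ _).1 hψ (x + G x)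
        ⟨⟨((x : H), G x), G.mem_graph x⟩, rfl⟩
      rw [inner_add_right] at this
      rw [inner_neg_left]; linear_combination -this
    have hmem : ψ ∈ G.adjoint.domain := LinearPMap.mem_adjoint_domain_of_exists ψ ⟨-ψ, h0⟩
    have hval : G.adjoint ⟨ψ, hmem⟩ = -ψ := LinearPMap.adjoint_apply_eq hG.dense ⟨ψ, hmem⟩ h0
    have hg : (ψ, -ψ) ∈ G.adjoint.graph := (LinearPMap.mem_graph_iff' _).2 ⟨⟨ψ, hmem⟩, by rw [hval]⟩
    rw [LinearPMap.isSelfAdjoint_def.1 hG.selfAdjoint] at hg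
    have h1 := hpos _ hg
    have h2 := norm_nonneg ψ
    have h3 : (inner ℂ ψ ψ).re = ‖ψ‖ ^ 2 := inner_self_eq_norm_sq (𝕜 := ℂ) ψ
    simp only [inner_neg_right, Complex.neg_re] at h1
    rw [h3] at h1
    exact norm_eq_zero.1 (pow_eq_zero_iff two_ne_zero |>.1 (le_antisymm (by linarith) (sq_nonneg _)))
  have hsurj : Function.Surjective L := by
    have : CompleteSpace L.range := hrc.completeSpace_coe
    have := Submodule.orthogonal_eq_bot_iff.1 hperp
    exact LinearMap.range_eq_top.1 this
  let e := LinearEquiv.ofBijective L.toLinearMap ⟨hanti.injective, hsurj⟩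
  have he : ∀ ψ, L (e.symm ψ) = ψ := fun ψ => e.apply_symm_apply ψ
  refine ⟨LinearMap.mkContinuous ((LinearMap.fst ℂ H H ∘ₗ G.graph.subtype) ∘ₗ e.symm.toLinearMap) 1
    (fun ψ => ?_), fun ψ => ?_⟩
  · have := hb1 _ (e.symm ψ).2
    rw [← hL, he] at this
    simpa using this
  · have h1 := (e.symm ψ).2
    have h2 := he ψ
    rw [hL] at h2
    convert h1 using 1
    refine Prod.ext rfl ?_
    change ψ - (e.symm ψ).1.1 = _
    rw [sub_eq_iff_eq_add, add_comm]; exact h2.symm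

theorem resolvent_mem_graph {G : H →ₗ.[ℂ] H} (hG : IsPositiveOperator G) (ψ : H) :
    (resolvent G ψ, ψ - resolvent G ψ) ∈ G.graph := by
  have h := resolvent_exists hG
  rw [resolvent, dif_pos h]
  exact h.choose_spec ψ

theorem inner_graph_symm {G : H →ₗ.[ℂ] H} (hG : IsPositiveOperator G) {p q : H × H}
    (hp : p ∈ G.graph) (hq : q ∈ G.graph) : inner ℂ p.2 q.1 = inner ℂ p.1 q.2 := by
  obtain ⟨x, rfl⟩ := (LinearPMap.mem_graph_iff' G).1 hp
  obtain ⟨y, rfl⟩ := (LinearPMap.mem_graph_iff' G).1 hq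
  have h := LinearPMap.adjoint_isFormalAdjoint hG.dense
  rw [LinearPMap.isSelfAdjoint_def.1 hG.selfAdjoint] at h
  exact h x y

theorem inner_graph_nonneg {G : H →ₗ.[ℂ] H} (hG : IsPositiveOperator G) {p : H × H}
    (hp : p ∈ G.graph) : 0 ≤ (inner ℂ p.1 p.2).re := by
  obtain ⟨x, rfl⟩ := (LinearPMap.mem_graph_iff' G).1 hp
  exact hG.nonneg x

theorem mem_graph_iff_resolvent {G : H →ₗ.[ℂ] H} (hG : IsPositiveOperator G) (p : H × H) :
    p ∈ G.graph ↔ resolvent G (p.1 + p.2) = p.1 := by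
  constructor
  · intro hp
    have h1 := sub_mem (resolvent_mem_graph hG (p.1 + p.2)) hp
    have h2 := inner_graph_nonneg hG h1
    set d := resolvent G (p.1 + p.2) - p.1 with hd
    have h3 : ((resolvent G (p.1 + p.2), p.1 + p.2 - resolvent G (p.1 + p.2)) - p : H × H)
        = (d, -d) := Prod.ext rfl (by
          change p.1 + p.2 - resolvent G (p.1 + p.2) - p.2 = -d
          rw [hd]; abel)
    rw [h3] at h2
    have h4 : (inner ℂ d d).re = ‖d‖ ^ 2 := inner_self_eq_norm_sq (𝕜 := ℂ) d
    simp only [inner_neg_right, Complex.neg_re, h4] at h2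
    have : d = 0 := norm_eq_zero.1
      (pow_eq_zero_iff two_ne_zero |>.1 (le_antisymm (by linarith) (sq_nonneg _)))
    exact sub_eq_zero.1 this
  · intro h
    have h1 := resolvent_mem_graph hG (p.1 + p.2)
    rw [h] at h1
    simpa using h1

theorem resolvent_isSymmetric {G : H →ₗ.[ℂ] H} (hG : IsPositiveOperator G) (a b : H) :
    inner ℂ (resolvent G a) b = inner ℂ a (resolvent G b) := by
  have h := inner_graph_symm hG (resolvent_mem_graph hG a) (resolvent_mem_graph hG b)
  simp only [inner_sub_left, inner_sub_right] at h
  linear_combination -h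

theorem resolvent_nonneg {G : H →ₗ.[ℂ] H} (hG : IsPositiveOperator G) : 0 ≤ resolvent G := by
  rw [ContinuousLinearMap.nonneg_iff_isPositive]
  refine ⟨fun a b => resolvent_isSymmetric hG a b, fun ψ => ?_⟩
  have h := inner_graph_nonneg hG (resolvent_mem_graph hG ψ)
  have h4 : (inner ℂ (resolvent G ψ) (resolvent G ψ)).re = ‖resolvent G ψ‖ ^ 2 :=
    inner_self_eq_norm_sq (𝕜 := ℂ) _
  simp only [inner_sub_right, Complex.sub_re, h4] at h
  change 0 ≤ (inner ℂ (resolvent G ψ) ψ).re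
  nlinarith [sq_nonneg ‖resolvent G ψ‖]

theorem one_sub_resolvent_nonneg {G : H →ₗ.[ℂ] H} (hG : IsPositiveOperator G) :
    0 ≤ 1 - resolvent G := by
  rw [ContinuousLinearMap.nonneg_iff_isPositive]
  refine ⟨fun a b => ?_, fun ψ => ?_⟩
  · have := resolvent_isSymmetric hG a b
    change inner ℂ (a - resolvent G a) b = inner ℂ a (b - resolvent G b)
    rw [inner_sub_left, inner_sub_right, this]
  · have h := inner_graph_nonneg hG (resolvent_mem_graph hG ψ)
    set d := ψ - resolvent G ψ with hd
    have h4 : (inner ℂ d d).re = ‖d‖ ^ 2 := inner_self_eq_norm_sq (𝕜 := ℂ) _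
    have h5 : (inner ℂ d (resolvent G ψ)).re = (inner ℂ (resolvent G ψ) d).re :=
      inner_re_symm (𝕜 := ℂ) _ _
    change 0 ≤ (inner ℂ d ψ).re
    have h6 : ψ = resolvent G ψ + d := by simp [hd]
    have h7 : (inner ℂ d ψ).re = (inner ℂ d (resolvent G ψ)).re + (inner ℂ d d).re := by
      conv_lhs => rw [h6, inner_add_right]
      rfl
    rw [h7, h5, h4]
    have : 0 ≤ (inner ℂ (resolvent G ψ) d).re := h
    positivity

theorem resolvent_injective {G : H →ₗ.[ℂ] H} (hG : IsPositiveOperator G) {ψ : H}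
    (h : resolvent G ψ = 0) : ψ = 0 := by
  have h1 := resolvent_mem_graph hG ψ
  rw [h, sub_zero] at h1
  exact LinearPMap.graph_fst_eq_zero_snd G h1 rfl

theorem mem_graph_sqrtOp {G : H →ₗ.[ℂ] H} (hG : IsPositiveOperator G) (p : H × H) :
    p ∈ (sqrtOp G).graph ↔
      ∃ ψ : H, p = (CFC.sqrt (resolvent G) ψ, CFC.sqrt (1 - resolvent G) ψ) := by
  set Q : H →L[ℂ] H := CFC.sqrt (resolvent G) with hQ
  have hinj : (Q.toLinearMap.toPMap ⊤).toFun.ker = ⊥ := by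
    rw [Submodule.eq_bot_iff]
    rintro ⟨x, hx⟩ h
    have h1 : Q x = 0 := h
    have h2 : resolvent G x = 0 := by
      rw [← CFC.sqrt_mul_sqrt_self (resolvent G) (resolvent_nonneg hG)]
      change Q (Q x) = 0
      rw [h1, map_zero]
    exact Subtype.ext (resolvent_injective hG h2)
  rw [LinearPMap.mem_graph_iff']
  constructor
  · rintro ⟨⟨y, hy⟩, rfl⟩
    have hy' := hy
    change y ∈ ((Q.toLinearMap.toPMap ⊤).inverse).domain at hy'
    rw [LinearPMap.inverse_domain] at hy'
    obtain ⟨x, hx⟩ := hy'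
    refine ⟨x, Prod.ext hx.symm ?_⟩
    have := LinearPMap.inverse_apply_eq hinj (y := ⟨y, hy⟩) (x := x) hx
    change CFC.sqrt (1 - resolvent G) ((Q.toLinearMap.toPMap ⊤).inverse ⟨y, hy⟩) = _
    rw [this]
  · rintro ⟨ψ, rfl⟩
    have hy : Q ψ ∈ ((Q.toLinearMap.toPMap ⊤).inverse).domain := by
      rw [LinearPMap.inverse_domain]
      exact ⟨⟨ψ, trivial⟩, rfl⟩
    refine ⟨⟨Q ψ, hy⟩, Prod.ext rfl ?_⟩
    have := LinearPMap.inverse_apply_eq hinj (y := ⟨Q ψ, hy⟩) (x := ⟨ψ, trivial⟩) rfl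
    change CFC.sqrt (1 - resolvent G) ((Q.toLinearMap.toPMap ⊤).inverse ⟨Q ψ, hy⟩) = _
    rw [this]

/-- `√G` is a positive self-adjoint operator and `√G √G = G`, including the domains. -/
theorem isSqrt_sqrtOp {G : H →ₗ.[ℂ] H} (hG : IsPositiveOperator G) :
    IsPositiveOperator (sqrtOp G) ∧
      ∀ φ χ : H, (φ, χ) ∈ G.graph ↔
        ∃ η : H, (φ, η) ∈ (sqrtOp G).graph ∧ (η, χ) ∈ (sqrtOp G).graph := by
  have hgr := mem_graph_sqrtOp hG
  have hR := resolvent_nonneg hG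
  have hR' := one_sub_resolvent_nonneg hG
  have hQ0 : 0 ≤ CFC.sqrt (resolvent G) := CFC.sqrt_nonneg _
  have hZ0 : 0 ≤ CFC.sqrt (1 - resolvent G) := CFC.sqrt_nonneg _
  have hQQ' := CFC.sqrt_mul_sqrt_self (resolvent G) hR
  have hZZ' := CFC.sqrt_mul_sqrt_self (1 - resolvent G) hR'
  have hc1 : Commute (CFC.sqrt (resolvent G)) (1 - resolvent G) := by
    have : Commute (CFC.sqrt (resolvent G)) (resolvent G) := by
      have h := (Commute.refl (CFC.sqrt (resolvent G))).mul_right (Commute.refl _)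
      rwa [hQQ'] at h
    exact (Commute.one_right _).sub_right this
  have hcomm : Commute (CFC.sqrt (resolvent G)) (CFC.sqrt (1 - resolvent G)) := by
    exact (hc1.symm.cfcₙ_nnreal _).symm
  set Q : H →L[ℂ] H := CFC.sqrt (resolvent G) with hQ
  set Z : H →L[ℂ] H := CFC.sqrt (1 - resolvent G) with hZ
  have hQQ : ∀ x, Q (Q x) = resolvent G x := fun x => by rw [← hQQ']; rfl
  have hZZ : ∀ x, Z (Z x) = x - resolvent G x := fun x => by
    have := congrArg (fun T : H →L[ℂ] H => T x) hZZ'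
    exact this
  have hQZ : ∀ x, Q (Z x) = Z (Q x) := fun x =>
    congrArg (fun T : H →L[ℂ] H => T x) hcomm.eq
  have hQs : ∀ x y, inner ℂ (Q x) y = inner ℂ x (Q y) :=
    ((ContinuousLinearMap.nonneg_iff_isPositive _).1 hQ0).1
  have hZs : ∀ x y, inner ℂ (Z x) y = inner ℂ x (Z y) :=
    ((ContinuousLinearMap.nonneg_iff_isPositive _).1 hZ0).1
  have hQinj : ∀ x, Q x = 0 → x = 0 := fun x hx =>
    resolvent_injective hG (by rw [← hQQ, hx, map_zero])
  have hdom : ∀ x, x ∈ (sqrtOp G).domain ↔ ∃ ψ, x = Q ψ := by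
    intro x
    rw [LinearPMap.mem_domain_iff]
    constructor
    · rintro ⟨y, hy⟩
      obtain ⟨ψ, h⟩ := (hgr _).1 hy
      exact ⟨ψ, congrArg Prod.fst h⟩
    · rintro ⟨ψ, rfl⟩
      exact ⟨Z ψ, (hgr _).2 ⟨ψ, rfl⟩⟩
  have hdense : Dense ((sqrtOp G).domain : Set H) := by
    rw [Submodule.dense_iff_topologicalClosure_eq_top,
      Submodule.topologicalClosure_eq_top_iff, Submodule.eq_bot_iff]
    intro x hx
    refine hQinj x (ext_inner_right ℂ fun y => ?_)
    rw [hQs, inner_zero_left]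
    exact (Submodule.mem_orthogonal' _ _).1 hx _ ((hdom _).2 ⟨y, rfl⟩)
  have hval : ∀ x : (sqrtOp G).domain, ∃ ψ, (x : H) = Q ψ ∧ sqrtOp G x = Z ψ := by
    intro x
    obtain ⟨ψ, h⟩ := (hgr _).1 ((sqrtOp G).mem_graph x)
    exact ⟨ψ, congrArg Prod.fst h, congrArg Prod.snd h⟩
  refine ⟨⟨hdense, ?_, ?_⟩, ?_⟩
  · rw [LinearPMap.isSelfAdjoint_def]
    have hfa := LinearPMap.adjoint_isFormalAdjoint hdense
    refine le_antisymm ?_ ?_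
    · refine LinearPMap.le_of_le_graph ?_
      rintro p hp
      obtain ⟨y, rfl⟩ := (LinearPMap.mem_graph_iff' _).1 hp
      set w := (sqrtOp G).adjoint y with hw
      have h1 : Q w = Z y := by
        refine ext_inner_right ℂ fun ψ => ?_
        rw [hQs, hZs]
        have hm : Q ψ ∈ (sqrtOp G).domain := (hdom _).2 ⟨ψ, rfl⟩
        have h2 := hfa y ⟨Q ψ, hm⟩
        have h3 : sqrtOp G ⟨Q ψ, hm⟩ = Z ψ := by
          obtain ⟨ψ', h4, h5⟩ := hval ⟨Q ψ, hm⟩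
          have h6 : Q (ψ - ψ') = 0 := by rw [map_sub, sub_eq_zero]; exact h4
          rw [h5, sub_eq_zero.1 (hQinj _ h6)]
        rw [h3] at h2
        exact h2
      refine (hgr _).2 ⟨Q y + Z w, Prod.ext ?_ ?_⟩
      · change (y : H) = Q (Q y + Z w)
        rw [map_add, hQQ, hQZ, h1, hZZ]; abel
      · change w = Z (Q y + Z w)
        rw [map_add, ← hQZ, ← h1, hQQ, hZZ]; abel
    · refine LinearPMap.IsFormalAdjoint.le_adjoint hdense ?_
      intro x y
      obtain ⟨a, ha1, ha2⟩ := hval x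
      obtain ⟨b, hb1, hb2⟩ := hval y
      rw [ha2, hb1, ha1, hb2, hZs, hQs, hQZ]
  · intro x
    obtain ⟨a, ha1, ha2⟩ := hval x
    rw [ha1, ha2, hQs]
    have hp : 0 ≤ Q * Z := hcomm.mul_nonneg hQ0 hZ0
    refine le_of_le_of_eq ?_ (inner_re_symm (𝕜 := ℂ) _ _)
    exact ((ContinuousLinearMap.nonneg_iff_isPositive _).1 hp).2 a
  · intro φ χ
    rw [mem_graph_iff_resolvent hG]
    constructor
    · intro h
      set ψ := φ + χ with hψ
      refine ⟨Z (Q ψ), (hgr _).2 ⟨Q ψ, Prod.ext ?_ rfl⟩, (hgr _).2 ⟨Z ψ, Prod.ext ?_ ?_⟩⟩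
      · change φ = Q (Q ψ)
        rw [hQQ]; exact h.symm
      · exact (hQZ ψ).symm
      · change χ = Z (Z ψ)
        rw [hZZ]
        have : resolvent G ψ = φ := h
        rw [this, hψ]; abel
    · rintro ⟨η, h1, h2⟩
      obtain ⟨a, ha⟩ := (hgr _).1 h1
      obtain ⟨b, hb⟩ := (hgr _).1 h2
      obtain ⟨ha1, ha2⟩ := Prod.ext_iff.1 ha
      obtain ⟨hb1, hb2⟩ := Prod.ext_iff.1 hb
      dsimp only at ha1 ha2 hb1 hb2 ⊢
      have h3 : Q b = Z a := hb1.symm.trans ha2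
      rw [ha1, hb2, ← hQQ, map_add, hQZ, h3, hZZ, hQQ]
      congr 1; abel

/-- `P_n` maps into `D(G)` and `G P_n` is bounded. -/
theorem truncOp_mem_graph {G : H →ₗ.[ℂ] H} (hG : IsPositiveOperator G) (n : ℕ) (φ : H) :
    (spectralProj G n φ, truncOp G n φ) ∈ G.graph := by
  have h : ∃ T : H →L[ℂ] H, ∀ φ : H, (spectralProj G n φ, T φ) ∈ G.graph := by
    have hsa : IsSelfAdjoint (resolvent G) := IsSelfAdjoint.of_nonneg (resolvent_nonneg hG)
    set c : ℝ := 1 / ((n : ℝ) + 1) with hc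
    have hc0 : 0 < c := by positivity
    have hcont : Continuous fun r : ℝ => (max r c)⁻¹ :=
      (continuous_id.max continuous_const).inv₀ fun r => (lt_max_of_lt_right hc0).ne'
    set h' : H →L[ℂ] H := cfc (fun r : ℝ => (max r c)⁻¹) (resolvent G) with hh'
    set f' : H →L[ℂ] H := cfc (fun r : ℝ => max (c - r) 0) (resolvent G) with hf'
    have key : resolvent G * h' = 1 - h' * f' := by
      have h1 : resolvent G * h' = cfc (fun r : ℝ => r * (max r c)⁻¹) (resolvent G) := by
        rw [cfc_mul (fun r : ℝ => r) (fun r : ℝ => (max r c)⁻¹) (resolvent G)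
          (by fun_prop) hcont.continuousOn, cfc_id' ℝ (resolvent G) hsa]
      have h2 : h' * f' = cfc (fun r : ℝ => (max r c)⁻¹ * max (c - r) 0) (resolvent G) := by
        rw [cfc_mul (fun r : ℝ => (max r c)⁻¹) (fun r : ℝ => max (c - r) 0) (resolvent G)
          hcont.continuousOn (by fun_prop)]
      have hcont2 : Continuous fun r : ℝ => (max r c)⁻¹ * max (c - r) 0 :=
        hcont.mul (by fun_prop)
      rw [h1, h2, ← cfc_const_one ℝ (resolvent G),
        ← cfc_sub (fun _ : ℝ => (1 : ℝ)) (fun r : ℝ => (max r c)⁻¹ * max (c - r) 0) (resolvent G)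
          (by fun_prop) hcont2.continuousOn]
      refine cfc_congr fun r _ => ?_
      rcases le_total c r with hr | hr
      · have : r ≠ 0 := (hc0.trans_le hr).ne'
        simp [max_eq_left hr, max_eq_right (sub_nonpos.2 hr), this]
      · simp only [max_eq_right hr, max_eq_left (sub_nonneg.2 hr)]
        field_simp
        ring
    refine ⟨(h' - 1) * spectralProj G n, fun φ => ?_⟩
    rw [mem_graph_iff_resolvent hG]
    set x := spectralProj G n φ with hx
    have hxk : f' x = 0 := Submodule.starProjection_apply_mem (U := f'.ker) φ
    have h1 : x + ((h' - 1) * spectralProj G n) φ = h' x := by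
      change x + (h' x - x) = h' x
      abel
    change resolvent G (x + ((h' - 1) * spectralProj G n) φ) = x
    rw [h1]
    have h2 := congrArg (fun T : H →L[ℂ] H => T x) key
    change resolvent G (h' x) = x - h' (f' x) at h2
    rw [h2, hxk, map_zero, sub_zero]
  rw [truncOp, dif_pos h]
  exact h.choose_spec φ

/-! ### Trace-class operators -/

/-- The index set of a fixed orthonormal basis of `H`. -/
noncomputable def basisIndex (H : Type*) [NormedAddCommGroup H] [InnerProductSpace ℂ H]
    [CompleteSpace H] : Set H :=
  (exists_hilbertBasis ℂ H).choose

/-- A fixed orthonormal basis of `H`. -/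
noncomputable def basis (H : Type*) [NormedAddCommGroup H] [InnerProductSpace ℂ H]
    [CompleteSpace H] : HilbertBasis (basisIndex H) ℂ H :=
  (exists_hilbertBasis ℂ H).choose_spec.choose

/-- The trace norm `‖T‖₁ = Tr |T|` in `[0, ∞]`. -/
noncomputable def traceNorm (T : H →L[ℂ] H) : ENNReal :=
  ∑' i, ENNReal.ofReal (inner ℂ (basis H i) (CFC.abs T (basis H i))).re

/-- `T` is a trace-class operator. -/
def IsTraceClass (T : H →L[ℂ] H) : Prop := traceNorm T ≠ ⊤

/-- The trace of a trace-class operator. -/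
noncomputable def trace (T : H →L[ℂ] H) : ℂ := ∑' i, inner ℂ (basis H i) (T (basis H i))

/-- `ρ` belongs to the positive part of the unit ball of the trace class:
`ρ ≥ 0` and `Tr ρ ≤ 1`. -/
structure IsSubState (ρ : H →L[ℂ] H) : Prop where
  traceClass : IsTraceClass ρ
  nonneg : 0 ≤ ρ
  trace_le : (trace ρ).re ≤ 1

/-- `ρ` is a state (density operator): `ρ ≥ 0` and `Tr ρ = 1`. -/
structure IsState (ρ : H →L[ℂ] H) : Prop where
  traceClass : IsTraceClass ρ
  nonneg : 0 ≤ ρ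
  trace_eq : trace ρ = 1

/-- `Tr G ρ = sup_n Tr (P_n G ρ)` in `[0, ∞]`, for a positive trace-class operator `ρ`. -/
noncomputable def traceEnergy (G : H →ₗ.[ℂ] H) (ρ : H →L[ℂ] H) : ENNReal :=
  ⨆ n : ℕ, ENNReal.ofReal (trace (truncOp G n * ρ)).re

/-! ### The operator E-norm -/

/-- The operator E-norm: the supremum of `‖A φ‖` over the unit vectors `φ` with
`⟨φ|G|φ⟩ ≤ E`. -/
noncomputable def opENorm (G : H →ₗ.[ℂ] H) (E : ℝ) (A : H →L[ℂ] H) : ℝ :=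
  sSup {r : ℝ | ∃ φ : H, ‖φ‖ = 1 ∧ energy G φ ≤ ENNReal.ofReal E ∧ r = ‖A φ‖}

/-- `m(A)`: the infimum of the spectrum of `|A|`. -/
noncomputable def absSpectrumInf (A : H →L[ℂ] H) : ℝ := sInf (spectrum ℝ (CFC.abs A))

/-! ### Maps on the algebra of bounded operators -/

/-- `Φ` is 2-positive: applying `Φ` to the entries of a positive 2 × 2 operator matrix gives a
positive operator matrix. -/
def IsTwoPositive (Φ : (H →L[ℂ] H) →ₗ[ℂ] (H →L[ℂ] H)) : Prop :=
  ∀ M : CStarMatrix (Fin 2) (Fin 2) (H →L[ℂ] H), 0 ≤ M → 0 ≤ M.map Φ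

/-- `Φs` is the predual map of `Φ`: it maps trace-class operators to trace-class operators and
`Tr Φ(A) ρ = Tr A Φs(ρ)` for all bounded `A` and trace-class `ρ`. -/
def IsPredual (Φ : (H →L[ℂ] H) →ₗ[ℂ] (H →L[ℂ] H))
    (Φs : {ρ : H →L[ℂ] H // IsTraceClass ρ} → {ρ : H →L[ℂ] H // IsTraceClass ρ}) : Prop :=
  ∀ (A : H →L[ℂ] H) (ρ : {ρ : H →L[ℂ] H // IsTraceClass ρ}),
    trace (Φ A * ρ.1) = trace (A * (Φs ρ).1)

/-- `Y_Φ(E) = sup {Tr G Φs(ρ) : ρ a state, Tr G ρ ≤ E}` in `[0, ∞]`, for the predual map `Φs`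
of `Φ`. -/
noncomputable def outputEnergy (G : H →ₗ.[ℂ] H)
    (Φs : {ρ : H →L[ℂ] H // IsTraceClass ρ} → {ρ : H →L[ℂ] H // IsTraceClass ρ}) (E : ℝ) :
    ENNReal :=
  ⨆ (ρ : {ρ : H →L[ℂ] H // IsTraceClass ρ}) (_ : IsState ρ.1)
    (_ : traceEnergy G ρ.1 ≤ ENNReal.ofReal E), traceEnergy G (Φs ρ).1

end

end OpENorm

/-! ### A lemma of Toeplitz–Hausdorff type -/

section SLemma

variable {V F₁ F₂ : Type*} [NormedAddCommGroup V] [InnerProductSpace ℂ V]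
  [NormedAddCommGroup F₁] [InnerProductSpace ℂ F₁] [NormedAddCommGroup F₂] [InnerProductSpace ℂ F₂]

/-! Parts A, B and C compare norms of single vectors: an estimate between `‖A φ‖` and `‖B φ‖` valid
for each admissible unit vector passes to the suprema. The substance lies in D and E, where mixed
states occur although the E-norm is a supremum over pure ones.

The bridge is convexity. By a Toeplitz–Hausdorff argument, the points `(‖√G φ‖², ‖A φ‖²)`, `φ` a
unit vector, lie below a line through `(E, f)`, where `f` is the squared E-norm of `A`; so `A*A ≤ μ
+ k G` as quadratic forms, with `μ, k ≥ 0` and `μ + k E = f` (`exists_multiplier`). Both signs come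
from choosing the slope nonnegative and from `inf G = 0`. Unlike the supremum, this inequality can
be summed: for a positive `σ` of trace at most one with `Tr Gσ ≤ Y` it bounds `‖A√σ‖₂²` by the
squared E-norm at level `Y` (`hsSq_mul_sqrt_le`). Since `√σ` need not map into the domain of `√G`,
the sum is made with the truncations `P_n √σ`, and then `n → ∞`.

For D, factor `AρB* = (A√ρ)(B√ρ)*` and apply the Cauchy–Schwarz inequality for Hilbert–Schmidt
operators. For E, the Kadison–Schwarz inequality gives `‖Φ(A)φ‖² ≤ ‖Φ(I)‖ Tr A*Aσ`, where `σ` is the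
image of the pure state `φ` under the predual map; the factor `K_Φ` comes from the same multiplier.
For the failure of adjoint invariance, a rank one operator between two orthogonal directions, only
one of which is free of energy, suffices. -/

theorem norm_sq_smul_add_smul {F : Type*} [NormedAddCommGroup F] [InnerProductSpace ℂ F]
    (a b : ℝ) (z : ℂ) (hz : ‖z‖ = 1) (x y : F) :
    ‖(a : ℂ) • x + (b * z) • y‖ ^ 2 =
      a ^ 2 * ‖x‖ ^ 2 + b ^ 2 * ‖y‖ ^ 2 + 2 * a * b * (z * inner ℂ x y).re := by
  have h := norm_add_sq (𝕜 := ℂ) ((a : ℂ) • x) ((b * z) • y)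
  rw [h, norm_smul, norm_smul, norm_mul, hz, inner_smul_left, inner_smul_right]
  simp only [Complex.norm_real, Complex.conj_ofReal, mul_pow, Real.norm_eq_abs, sq_abs, mul_one]
  have : (a : ℂ) * (b * z * inner ℂ x y) = ((a * b : ℝ) : ℂ) * (z * inner ℂ x y) := by
    push_cast; ring
  rw [this]
  change _ + 2 * (((a * b : ℝ) : ℂ) * (z * inner ℂ x y)).re + _ = _
  rw [Complex.re_ofReal_mul]
  ring

theorem exists_norm_one_re_mul_eq_zero (w : ℂ) : ∃ z : ℂ, ‖z‖ = 1 ∧ (z * w).re = 0 := by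
  by_cases hw : w = 0
  · exact ⟨1, by simp, by simp [hw]⟩
  · have hn : (‖w‖ : ℂ) ≠ 0 := by exact_mod_cast norm_ne_zero_iff.2 hw
    refine ⟨Complex.I * (starRingEnd ℂ w / ‖w‖), by simp [hw], ?_⟩
    have : Complex.I * (starRingEnd ℂ w / ‖w‖) * w = Complex.I * (‖w‖ : ℝ) := by
      field_simp
      rw [mul_comm, Complex.mul_conj, Complex.normSq_eq_norm_sq]
      push_cast; ring
    rw [this]; simp

/-- Convexity of the joint range of the two forms `‖L ·‖²` and `‖M ·‖²` on the unit sphere, in the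
form needed: the chord over `u` and `v` is met by a unit vector exactly above the abscissa `E`. -/
theorem exists_unit_interpolating (L : V →ₗ[ℂ] F₁) (M : V →ₗ[ℂ] F₂) {u v : V} (hu : ‖u‖ = 1)
    (hv : ‖v‖ = 1) {E : ℝ} (huE : ‖L u‖ ^ 2 < E) (hvE : E < ‖L v‖ ^ 2) :
    ∃ w : V, ‖w‖ = 1 ∧ ‖L w‖ ^ 2 = E ∧
      (‖M w‖ ^ 2 - ‖M u‖ ^ 2) * (‖L v‖ ^ 2 - ‖L u‖ ^ 2) =
        (‖M v‖ ^ 2 - ‖M u‖ ^ 2) * (E - ‖L u‖ ^ 2) := by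
  -- `s` is the slope and `c` the intercept of the chord, so the Hermitian form `‖M ·‖² - s‖L ·‖² -
  -- c‖·‖²` vanishes at `u` and at `v`.
  set s : ℝ := (‖M v‖ ^ 2 - ‖M u‖ ^ 2) / (‖L v‖ ^ 2 - ‖L u‖ ^ 2) with hs
  have hd : ‖L v‖ ^ 2 - ‖L u‖ ^ 2 ≠ 0 := by linarith
  have hsd : s * (‖L v‖ ^ 2 - ‖L u‖ ^ 2) = ‖M v‖ ^ 2 - ‖M u‖ ^ 2 := div_mul_cancel₀ _ hd
  set c : ℝ := ‖M u‖ ^ 2 - s * ‖L u‖ ^ 2 with hc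
  -- This phase kills the cross term of that form between `u` and `z • v`; hence the form vanishes
  -- on the whole path `w`.
  obtain ⟨z, hz, hz0⟩ := exists_norm_one_re_mul_eq_zero
    (inner ℂ (M u) (M v) - s * inner ℂ (L u) (L v) - c * inner ℂ u v)
  set w : ℝ → V := fun t => (((1 - t : ℝ) : ℂ)) • u + (t * z) • v with hw
  have hLw : ∀ t, L (w t) = (((1 - t : ℝ) : ℂ)) • L u + (t * z) • L v := fun t => by
    simp only [hw, map_add, map_smul]
  have hMw : ∀ t, M (w t) = (((1 - t : ℝ) : ℂ)) • M u + (t * z) • M v := fun t => by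
    simp only [hw, map_add, map_smul]
  have hline : ∀ t, ‖M (w t)‖ ^ 2 = s * ‖L (w t)‖ ^ 2 + c * ‖w t‖ ^ 2 := by
    intro t
    rw [hLw, hMw, norm_sq_smul_add_smul _ _ _ hz, norm_sq_smul_add_smul _ _ _ hz,
      norm_sq_smul_add_smul _ _ _ hz, hu, hv]
    have h1 : (z * (inner ℂ (M u) (M v) - s * inner ℂ (L u) (L v) - c * inner ℂ u v)).re =
        (z * inner ℂ (M u) (M v)).re - s * (z * inner ℂ (L u) (L v)).re
          - c * (z * inner ℂ u v).re := by
      have : z * (inner ℂ (M u) (M v) - s * inner ℂ (L u) (L v) - c * inner ℂ u v) =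
          z * inner ℂ (M u) (M v) - s * (z * inner ℂ (L u) (L v)) - c * (z * inner ℂ u v) := by
        ring
      rw [this, Complex.sub_re, Complex.sub_re, Complex.re_ofReal_mul, Complex.re_ofReal_mul]
    rw [h1] at hz0
    linear_combination (2 * (1 - t) * t) * hz0 - t ^ 2 * hsd + (t ^ 2 - (1 - t) ^ 2) * hc
      - 2 * t ^ 2 * hc
  set q : ℝ → ℝ := fun t => ‖L (w t)‖ ^ 2 - E * ‖w t‖ ^ 2 with hq
  have hcont : Continuous q := by
    have : Continuous w := by simp only [hw]; fun_prop
    have h2 : Continuous fun t => L (w t) := by simp only [hLw]; fun_prop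
    exact (h2.norm.pow 2).sub (continuous_const.mul (this.norm.pow 2))
  have hzv : ‖z • v‖ = 1 := by rw [norm_smul, hz, hv, one_mul]
  have hw0 : w 0 = u := by simp [hw]
  have hw1 : w 1 = z • v := by simp [hw]
  have hLw1 : ‖L (w 1)‖ = ‖L v‖ := by rw [hw1, map_smul, norm_smul, hz, one_mul]
  have hq0 : q 0 ≤ 0 := by simp only [hq, hw0, hu]; linarith
  have hq1 : 0 ≤ q 1 := by
    simp only [hq, hLw1]; rw [hw1, hzv]; linarith
  obtain ⟨t, -, ht⟩ := intermediate_value_Icc zero_le_one hcont.continuousOn ⟨hq0, hq1⟩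
  have hLE : ‖L (w t)‖ ^ 2 = E * ‖w t‖ ^ 2 := sub_eq_zero.1 ht
  -- Otherwise `u` and `v` would be proportional, which forces `‖L u‖ = ‖L v‖`.
  have hwt : w t ≠ 0 := by
    intro h
    have h1 : ((1 - t : ℝ) : ℂ) • u = -((t * z) • v) := eq_neg_of_add_eq_zero_left h
    have h2 := congrArg norm h1
    have h3 := congrArg (fun x => ‖L x‖) h1
    simp only [map_smul, map_neg, norm_neg, norm_smul, norm_mul, hz, hu, hv, mul_one] at h2 h3
    rw [h2] at h3
    rcases mul_eq_mul_left_iff.1 h3 with h4 | h4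
    · rw [h4] at huE; linarith
    · rw [h4] at h2
      have h5 : t = 0 := by simpa using h4
      rw [h5] at h2; simp at h2
  have hn : ‖w t‖ ≠ 0 := norm_ne_zero_iff.2 hwt
  refine ⟨((‖w t‖⁻¹ : ℝ) : ℂ) • w t, ?_, ?_, ?_⟩
  · rw [norm_smul, Complex.norm_real, norm_inv, norm_norm, inv_mul_cancel₀ hn]
  · rw [map_smul, norm_smul, mul_pow, hLE, Complex.norm_real, norm_inv, norm_norm]
    field_simp
  · have : ‖M (((‖w t‖⁻¹ : ℝ) : ℂ) • w t)‖ ^ 2 = s * E + c := by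
      rw [map_smul, norm_smul, mul_pow, hline, hLE, Complex.norm_real, norm_inv, norm_norm]
      field_simp
    rw [this, hc, ← hsd]; ring

/-- A Lagrange multiplier for the maximum of `‖M w‖²` over the unit vectors with `‖L w‖² ≤ E`. -/
theorem exists_multiplier (L : V →ₗ[ℂ] F₁) (M : V →ₗ[ℂ] F₂) {E f : ℝ} (hE : 0 < E)
    (hinf : ∀ ε > 0, ∃ u : V, ‖u‖ = 1 ∧ ‖L u‖ ^ 2 < ε)
    (hf : ∀ w : V, ‖w‖ = 1 → ‖L w‖ ^ 2 ≤ E → ‖M w‖ ^ 2 ≤ f) :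
    ∃ μ k : ℝ, 0 ≤ μ ∧ 0 ≤ k ∧ μ + k * E = f ∧
      ∀ v : V, ‖M v‖ ^ 2 ≤ μ * ‖v‖ ^ 2 + k * ‖L v‖ ^ 2 := by
  -- Slopes of the lines from `(E, f)` to the points of the joint range on its right; the multiplier
  -- `k` is their supremum, and the extra element `0` makes it nonnegative.
  set S : Set ℝ := insert 0 {r | ∃ v : V, ‖v‖ = 1 ∧ E < ‖L v‖ ^ 2 ∧
    r = (‖M v‖ ^ 2 - f) / (‖L v‖ ^ 2 - E)} with hS
  -- A slope to the right of `E` never exceeds a slope to the left: the chord from `u` to `v`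
  -- carries a point above `E`, which has height at most `f`.
  have hub : ∀ u : V, ‖u‖ = 1 → ‖L u‖ ^ 2 < E →
      ∀ r ∈ S, r ≤ (f - ‖M u‖ ^ 2) / (E - ‖L u‖ ^ 2) := by
    rintro u hu huE r (rfl | ⟨v, hv, hvE, rfl⟩)
    · exact div_nonneg (sub_nonneg.2 (hf u hu huE.le)) (sub_nonneg.2 huE.le)
    · obtain ⟨w, hw, hwE, hwM⟩ := exists_unit_interpolating L M hu hv huE hvE
      have h1 := hf w hw hwE.le
      rw [div_le_div_iff₀ (by linarith) (by linarith)]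
      nlinarith [mul_le_mul_of_nonneg_right h1 (by linarith : 0 ≤ ‖L v‖ ^ 2 - ‖L u‖ ^ 2)]
  obtain ⟨u₀, hu₀, hu₀E⟩ := hinf E hE
  have hbdd : BddAbove S := ⟨_, fun r hr => hub u₀ hu₀ hu₀E r hr⟩
  have hne : S.Nonempty := ⟨0, Set.mem_insert _ _⟩
  have hk0 : 0 ≤ sSup S := le_csSup hbdd (Set.mem_insert _ _)
  have hkf : ∀ u : V, ‖u‖ = 1 → ‖L u‖ ^ 2 < E →
      sSup S * (E - ‖L u‖ ^ 2) ≤ f - ‖M u‖ ^ 2 := fun u hu huE => by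
    rw [← le_div_iff₀ (by linarith)]
    exact csSup_le hne (hub u hu huE)
  -- The supporting line has nonnegative height at abscissa `0`, because there are points of
  -- nonnegative height with abscissa arbitrarily near `0`.
  have hμ : sSup S * E ≤ f := by
    refine le_of_forall_pos_le_add fun ε hε => ?_
    obtain ⟨u, hu, hu'⟩ := hinf (min E (ε / (sSup S + 1))) (by positivity)
    have h1 := hkf u hu (hu'.trans_le (min_le_left _ _))
    have h2 : ‖L u‖ ^ 2 * (sSup S + 1) < ε :=
      (lt_div_iff₀ (by positivity)).1 (hu'.trans_le (min_le_right _ _))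
    nlinarith [sq_nonneg ‖M u‖, sq_nonneg ‖L u‖]
  have hunit : ∀ v : V, ‖v‖ = 1 → ‖M v‖ ^ 2 ≤ f - sSup S * E + sSup S * ‖L v‖ ^ 2 := by
    intro v hv
    rcases lt_trichotomy (‖L v‖ ^ 2) E with h | h | h
    · have := hkf v hv h; nlinarith
    · rw [h]; linarith [hf v hv h.le]
    · have h1 : (‖M v‖ ^ 2 - f) / (‖L v‖ ^ 2 - E) ≤ sSup S :=
        le_csSup hbdd (Set.mem_insert_of_mem _ ⟨v, hv, h, rfl⟩)
      rw [div_le_iff₀ (by linarith)] at h1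
      nlinarith
  refine ⟨f - sSup S * E, sSup S, by linarith, hk0, by ring, fun v => ?_⟩
  by_cases hv : v = 0
  · simp [hv]
  · have hn : ‖v‖ ≠ 0 := norm_ne_zero_iff.2 hv
    have h1 := hunit (((‖v‖⁻¹ : ℝ) : ℂ) • v)
      (by rw [norm_smul, Complex.norm_real, norm_inv, norm_norm, inv_mul_cancel₀ hn])
    simp only [map_smul, norm_smul, Complex.norm_real, norm_inv, norm_norm, mul_pow, inv_pow] at h1
    have hp : 0 < ‖v‖ ^ 2 := by positivity
    have h2 := mul_le_mul_of_nonneg_left h1 hp.le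
    rw [mul_inv_cancel_left₀ hp.ne'] at h2
    refine h2.trans_eq ?_
    field_simp

end SLemma

namespace OpENorm

/-! ### Pointwise estimates for the E-norm -/

section ENorm

variable {H : Type*} [NormedAddCommGroup H] [InnerProductSpace ℂ H]

theorem re_inner_self (x : H) : (inner ℂ x x).re = ‖x‖ ^ 2 := inner_self_eq_norm_sq (𝕜 := ℂ) x

theorem inner_symm_of_nonneg {T : H →L[ℂ] H} (hT : 0 ≤ T) (x y : H) :
    inner ℂ (T x) y = inner ℂ x (T y) :=
  ((ContinuousLinearMap.nonneg_iff_isPositive T).1 hT).1 x y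

theorem re_inner_nonneg_of_nonneg {T : H →L[ℂ] H} (hT : 0 ≤ T) (x : H) :
    0 ≤ (inner ℂ x (T x)).re :=
  (((ContinuousLinearMap.nonneg_iff_isPositive T).1 hT).2 x).trans_eq (inner_re_symm (𝕜 := ℂ) _ _)

theorem norm_add_apply_sq {A B : H →L[ℂ] H} (h : ∀ φ : H, inner ℂ (A φ) (B φ) = 0) (φ : H) :
    ‖(A + B) φ‖ ^ 2 = ‖A φ‖ ^ 2 + ‖B φ‖ ^ 2 := by
  have := norm_add_sq_eq_norm_sq_add_norm_sq_of_inner_eq_zero (𝕜 := ℂ) (A φ) (B φ) (h φ)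
  rw [sq, sq, sq]; exact this

variable [CompleteSpace H]

theorem inner_star_left (A : H →L[ℂ] H) (x y : H) : inner ℂ (star A x) y = inner ℂ x (A y) :=
  ContinuousLinearMap.adjoint_inner_left A y x

theorem inner_star_right (A : H →L[ℂ] H) (x y : H) : inner ℂ x (star A y) = inner ℂ (A x) y :=
  ContinuousLinearMap.adjoint_inner_right A x y

theorem norm_abs_apply (A : H →L[ℂ] H) (x : H) : ‖CFC.abs A x‖ = ‖A x‖ := by
  have h : ‖CFC.abs A x‖ ^ 2 = ‖A x‖ ^ 2 := by
    rw [← re_inner_self, ← re_inner_self, inner_symm_of_nonneg (CFC.abs_nonneg A),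
      ← inner_star_right]
    congr 2
    exact congrArg (fun T : H →L[ℂ] H => T x) (CFC.abs_mul_abs A)
  exact (pow_left_inj₀ (norm_nonneg _) (norm_nonneg _) two_ne_zero).1 h

theorem energy_eq_of_mem_graph {G : H →ₗ.[ℂ] H} {φ η : H} (h : (φ, η) ∈ (sqrtOp G).graph) :
    energy G φ = ENNReal.ofReal (‖η‖ ^ 2) := by
  obtain ⟨⟨x, hx⟩, h1, h2⟩ := (LinearPMap.mem_graph_iff _).1 h
  dsimp only at h1 h2
  subst h1
  rw [energy, dif_pos hx, h2]

theorem energy_le_ofReal_iff {G : H →ₗ.[ℂ] H} {E : ℝ} (hE : 0 ≤ E) (φ : H) :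
    energy G φ ≤ ENNReal.ofReal E ↔ ∃ η, (φ, η) ∈ (sqrtOp G).graph ∧ ‖η‖ ^ 2 ≤ E := by
  constructor
  · intro h
    by_cases hφ : φ ∈ (sqrtOp G).domain
    · rw [energy, dif_pos hφ, ENNReal.ofReal_le_ofReal_iff hE] at h
      exact ⟨_, (sqrtOp G).mem_graph ⟨φ, hφ⟩, h⟩
    · rw [energy, dif_neg hφ] at h
      exact absurd h (by simp)
  · rintro ⟨η, h1, h2⟩
    rw [energy_eq_of_mem_graph h1]
    exact ENNReal.ofReal_le_ofReal h2

theorem exists_mem_graph_sqrtOp {G : H →ₗ.[ℂ] H} (hG : IsPositiveOperator G) {φ χ : H}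
    (h : (φ, χ) ∈ G.graph) :
    ∃ η, (φ, η) ∈ (sqrtOp G).graph ∧ (η, χ) ∈ (sqrtOp G).graph ∧
      (inner ℂ φ χ).re = ‖η‖ ^ 2 := by
  obtain ⟨hs, hsq⟩ := isSqrt_sqrtOp hG
  obtain ⟨η, h1, h2⟩ := (hsq φ χ).1 h
  refine ⟨η, h1, h2, ?_⟩
  rw [← re_inner_self, inner_graph_symm hs h1 h2]

theorem energy_eq_re_inner {G : H →ₗ.[ℂ] H} (hG : IsPositiveOperator G) {φ χ : H}
    (h : (φ, χ) ∈ G.graph) : energy G φ = ENNReal.ofReal (inner ℂ φ χ).re := by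
  obtain ⟨η, h1, -, h2⟩ := exists_mem_graph_sqrtOp hG h
  rw [h2, energy_eq_of_mem_graph h1]

/-- For a unit vector in the domain of `G`, `‖√G φ‖² = ⟨φ, G φ⟩ ≤ ‖G φ‖`, so the zero infimum passes
from `G` to `√G`. -/
theorem exists_unit_sqrtOp_lt {G : H →ₗ.[ℂ] H} (hG : IsPositiveOperator G) (h0 : HasZeroInf G)
    {ε : ℝ} (hε : 0 < ε) :
    ∃ u : (sqrtOp G).domain, ‖u‖ = 1 ∧ ‖(sqrtOp G).toFun u‖ ^ 2 < ε := by
  obtain ⟨r, ⟨φ, hφ, rfl⟩, -, hr⟩ := h0.exists_between hε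
  obtain ⟨η, h1, -, h2⟩ := exists_mem_graph_sqrtOp hG (G.mem_graph φ)
  obtain ⟨u, hu1, hu2⟩ := (LinearPMap.mem_graph_iff _).1 h1
  refine ⟨u, ?_, ?_⟩
  · rw [← hφ]; exact congrArg norm hu1
  · change ‖sqrtOp G u‖ ^ 2 < ε
    rw [hu2]
    dsimp only
    rw [← h2]
    refine lt_of_le_of_lt ?_ hr
    have := Complex.re_le_norm (inner ℂ (φ : H) (G φ))
    have h3 := norm_inner_le_norm (𝕜 := ℂ) (φ : H) (G φ)
    rw [hφ, one_mul] at h3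
    exact this.trans h3

variable (G : H →ₗ.[ℂ] H) (E : ℝ)

theorem norm_le_opENorm (A : H →L[ℂ] H) {φ : H} (hφ : ‖φ‖ = 1)
    (hE : energy G φ ≤ ENNReal.ofReal E) : ‖A φ‖ ≤ opENorm G E A := by
  refine le_csSup ⟨‖A‖, ?_⟩ ⟨φ, hφ, hE, rfl⟩
  rintro r ⟨ψ, hψ, -, rfl⟩
  exact (A.le_opNorm ψ).trans_eq (by rw [hψ, mul_one])

theorem opENorm_nonneg (A : H →L[ℂ] H) : 0 ≤ opENorm G E A := by
  refine Real.sSup_nonneg ?_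
  rintro r ⟨ψ, -, -, rfl⟩
  exact norm_nonneg _

theorem opENorm_le (A : H →L[ℂ] H) {r : ℝ} (hr : 0 ≤ r)
    (h : ∀ φ : H, ‖φ‖ = 1 → energy G φ ≤ ENNReal.ofReal E → ‖A φ‖ ≤ r) : opENorm G E A ≤ r := by
  refine Real.sSup_le ?_ hr
  rintro r ⟨ψ, h1, h2, rfl⟩
  exact h ψ h1 h2

theorem opENorm_abs (A : H →L[ℂ] H) : opENorm G E (CFC.abs A) = opENorm G E A := by
  simp only [opENorm, norm_abs_apply]

/-- For a unit vector, `‖A φ‖² = ⟨φ, A*A φ⟩ ≤ ‖A*A φ‖`. -/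
theorem opENorm_le_sqrt (A : H →L[ℂ] H) : opENorm G E A ≤ √(opENorm G E (star A * A)) := by
  refine opENorm_le G E A (Real.sqrt_nonneg _) fun φ h1 h2 => Real.le_sqrt_of_sq_le ?_
  refine le_trans ?_ (norm_le_opENorm G E (star A * A) h1 h2)
  have h3 := (Complex.re_le_norm _).trans (norm_inner_le_norm (𝕜 := ℂ) φ (star A (A φ)))
  rw [inner_star_right, re_inner_self, h1, one_mul] at h3
  exact h3

theorem absSpectrumInf_nonneg (A : H →L[ℂ] H) : 0 ≤ absSpectrumInf A :=
  Real.sInf_nonneg fun _ hr => spectrum_nonneg_of_nonneg (CFC.abs_nonneg A) hr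

/-- The spectral bound `m(A) ≤ |A|` gives `m(A)‖x‖² ≤ ⟨x, |A| x⟩ ≤ ‖x‖ ‖A x‖`. -/
theorem absSpectrumInf_mul_norm_le (A : H →L[ℂ] H) (x : H) : absSpectrumInf A * ‖x‖ ≤ ‖A x‖ := by
  have h1 : algebraMap ℝ (H →L[ℂ] H) (absSpectrumInf A) ≤ CFC.abs A := by
    rw [algebraMap_le_iff_le_spectrum (ha := IsSelfAdjoint.of_nonneg (CFC.abs_nonneg A))]
    intro r hr
    exact csInf_le ⟨0, fun r hr => spectrum_nonneg_of_nonneg (CFC.abs_nonneg A) hr⟩ hr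
  have h2 := re_inner_nonneg_of_nonneg (sub_nonneg.2 h1) x
  rw [Algebra.algebraMap_eq_smul_one] at h2
  change 0 ≤ (inner ℂ x (CFC.abs A x - absSpectrumInf A • x)).re at h2
  rw [inner_sub_right, Complex.sub_re, ← Complex.coe_smul, inner_smul_right, Complex.re_ofReal_mul,
    re_inner_self] at h2
  have h3 := (Complex.re_le_norm _).trans (norm_inner_le_norm (𝕜 := ℂ) x (CFC.abs A x))
  rw [norm_abs_apply] at h3
  rcases (norm_nonneg x).eq_or_lt with h | h
  · rw [← h, mul_zero]; exact norm_nonneg _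
  · exact le_of_mul_le_mul_left (by nlinarith : ‖x‖ * (absSpectrumInf A * ‖x‖) ≤ ‖x‖ * ‖A x‖) h

theorem absSpectrumInf_mul_opENorm_le (A B : H →L[ℂ] H) :
    absSpectrumInf A * opENorm G E B ≤ opENorm G E (A * B) := by
  rcases (absSpectrumInf_nonneg A).eq_or_lt with h | h
  · rw [← h, zero_mul]; exact opENorm_nonneg _ _ _
  · rw [mul_comm, ← le_div_iff₀ h]
    refine opENorm_le G E B (div_nonneg (opENorm_nonneg _ _ _) h.le) fun φ h1 h2 => ?_
    rw [le_div_iff₀ h, mul_comm]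
    exact (absSpectrumInf_mul_norm_le A (B φ)).trans (norm_le_opENorm G E (A * B) h1 h2)

theorem opENorm_mul_le (A B : H →L[ℂ] H) : opENorm G E (A * B) ≤ ‖A‖ * opENorm G E B :=
  opENorm_le G E _ (mul_nonneg (norm_nonneg _) (opENorm_nonneg _ _ _)) fun _ h1 h2 =>
    (A.le_opNorm _).trans
      (mul_le_mul_of_nonneg_left (norm_le_opENorm G E B h1 h2) (norm_nonneg _))

variable {A B : H →L[ℂ] H}

theorem max_opENorm_le_opENorm_add (h : ∀ φ : H, inner ℂ (A φ) (B φ) = 0) :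
    max (opENorm G E A) (opENorm G E B) ≤ opENorm G E (A + B) := by
  have key := norm_add_apply_sq h
  refine max_le ?_ ?_ <;>
  · refine opENorm_le G E _ (opENorm_nonneg _ _ _) fun φ h1 h2 => ?_
    refine le_trans ?_ (norm_le_opENorm G E (A + B) h1 h2)
    refine (pow_le_pow_iff_left₀ (norm_nonneg _) (norm_nonneg _) two_ne_zero).1 ?_
    rw [key]; nlinarith [sq_nonneg ‖A φ‖, sq_nonneg ‖B φ‖]

theorem opENorm_add_le_sqrt (h : ∀ φ : H, inner ℂ (A φ) (B φ) = 0) :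
    opENorm G E (A + B) ≤ √(opENorm G E A ^ 2 + opENorm G E B ^ 2) := by
  refine opENorm_le G E _ (Real.sqrt_nonneg _) fun φ h1 h2 => Real.le_sqrt_of_sq_le ?_
  rw [norm_add_apply_sq h]
  gcongr
  · exact norm_le_opENorm G E A h1 h2
  · exact norm_le_opENorm G E B h1 h2

end ENorm

/-! ### The multiplier inequality for the E-norm -/

section Multiplier

variable {H : Type*} [NormedAddCommGroup H] [InnerProductSpace ℂ H] [CompleteSpace H]
  {G : H →ₗ.[ℂ] H} {E : ℝ}

/-- The form inequality `A*A ≤ μ + k G` on the domain of `√G`. Being additive over families of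
vectors, it carries bounds from pure to mixed states. -/
theorem exists_multiplier_opENorm (hG : IsPositiveOperator G) (h0 : HasZeroInf G) (hE : 0 < E)
    (A : H →L[ℂ] H) :
    ∃ μ k : ℝ, 0 ≤ μ ∧ 0 ≤ k ∧ μ + k * E = opENorm G E A ^ 2 ∧
      ∀ φ η : H, (φ, η) ∈ (sqrtOp G).graph → ‖A φ‖ ^ 2 ≤ μ * ‖φ‖ ^ 2 + k * ‖η‖ ^ 2 := by
  obtain ⟨μ, k, hμ, hk, h1, h2⟩ := exists_multiplier (sqrtOp G).toFun
    (A.toLinearMap ∘ₗ (sqrtOp G).domain.subtype) hE (fun ε hε => exists_unit_sqrtOp_lt hG h0 hε)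
    (f := opENorm G E A ^ 2) (fun w hw hwE => by
      refine pow_le_pow_left₀ (norm_nonneg _) (norm_le_opENorm G E A hw ?_) 2
      rw [energy_le_ofReal_iff hE.le]
      exact ⟨_, (sqrtOp G).mem_graph w, hwE⟩)
  refine ⟨μ, k, hμ, hk, h1, fun φ η h => ?_⟩
  obtain ⟨x, rfl, rfl⟩ := (LinearPMap.mem_graph_iff _).1 h
  exact h2 x

/-- Replaces the multiplier at `E = 0`, where only the kernel of `√G` is admissible. If that kernel
is trivial then `φ = 0`, in agreement with the supremum of the empty set being `0`. -/
theorem norm_sq_le_of_mem_graph_zero (A : H →L[ℂ] H) {φ : H} (h : (φ, 0) ∈ (sqrtOp G).graph) :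
    ‖A φ‖ ^ 2 ≤ opENorm G 0 A ^ 2 * ‖φ‖ ^ 2 := by
  by_cases hφ : φ = 0
  · simp [hφ]
  have hn : ‖φ‖ ≠ 0 := norm_ne_zero_iff.2 hφ
  have h1 := (sqrtOp G).graph.smul_mem ((‖φ‖⁻¹ : ℝ) : ℂ) h
  rw [Prod.smul_mk, smul_zero] at h1
  have h2 := norm_le_opENorm G 0 A (φ := ((‖φ‖⁻¹ : ℝ) : ℂ) • φ)
    (by rw [norm_smul, Complex.norm_real, norm_inv, norm_norm, inv_mul_cancel₀ hn])
    (by rw [energy_eq_of_mem_graph h1]; simp)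
  rw [map_smul, norm_smul, Complex.norm_real, norm_inv, norm_norm, inv_mul_le_iff₀ (by positivity)]
    at h2
  rw [← mul_pow, mul_comm]
  exact pow_le_pow_left₀ (norm_nonneg _) h2 2

/-- The square of the E-norm is a concave function of `E`, hence grows at most linearly. -/
theorem opENorm_sq_le_max_mul (hG : IsPositiveOperator G) (h0 : HasZeroInf G) (hE : 0 < E) {Y : ℝ}
    (hY : 0 ≤ Y) (A : H →L[ℂ] H) :
    opENorm G Y A ^ 2 ≤ max 1 (Y / E) * opENorm G E A ^ 2 := by
  obtain ⟨μ, k, hμ, hk, h1, h2⟩ := exists_multiplier_opENorm hG h0 hE A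
  have hm : 0 ≤ max 1 (Y / E) * opENorm G E A ^ 2 := by positivity
  have hY' : Y ≤ max 1 (Y / E) * E := (div_le_iff₀ hE).1 (le_max_right _ _)
  refine (Real.le_sqrt (opENorm_nonneg _ _ _) hm).1
    (opENorm_le G Y A (Real.sqrt_nonneg _) fun φ hφ hφY => Real.le_sqrt_of_sq_le ?_)
  obtain ⟨η, h3, h4⟩ := (energy_le_ofReal_iff hY φ).1 hφY
  have h5 := h2 φ η h3
  rw [hφ] at h5
  rw [← h1]
  -- With `m = max 1 (Y / E)`, both `μ ≤ m μ` and `k Y ≤ m k E`, whence `μ + k Y ≤ m (μ + k E)`.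
  nlinarith [le_max_left 1 (Y / E), mul_le_mul_of_nonneg_left (h4.trans hY') hk]

end Multiplier

/-! ### Spectral truncations of `G` -/

section SpectralProj

variable {H : Type*} [NormedAddCommGroup H] [InnerProductSpace ℂ H]

theorem starProjection_apply_comm {K : Submodule ℂ H} [K.HasOrthogonalProjection] {T : H →L[ℂ] H}
    (hT : ∀ x y, inner ℂ (T x) y = inner ℂ x (T y)) (hK : ∀ x ∈ K, T x ∈ K) (x : H) :
    K.starProjection (T x) = T (K.starProjection x) := by
  refine Submodule.eq_starProjection_of_mem_of_inner_eq_zero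
    (hK _ (Submodule.starProjection_apply_mem _ _)) fun w hw => ?_
  rw [← map_sub, hT]
  exact Submodule.starProjection_inner_eq_zero x _ (hK _ hw)

variable [CompleteSpace H] {G : H →ₗ.[ℂ] H}

theorem spectralProj_inner_symm (G : H →ₗ.[ℂ] H) (n : ℕ) (x y : H) :
    inner ℂ (spectralProj G n x) y = inner ℂ x (spectralProj G n y) :=
  Submodule.inner_starProjection_left_eq_right _ x y

theorem spectralProj_idem (G : H →ₗ.[ℂ] H) (n : ℕ) (x : H) :
    spectralProj G n (spectralProj G n x) = spectralProj G n x :=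
  Submodule.starProjection_eq_self_iff.2 (Submodule.starProjection_apply_mem _ x)

theorem norm_spectralProj_apply_le (G : H →ₗ.[ℂ] H) (n : ℕ) (x : H) :
    ‖spectralProj G n x‖ ≤ ‖x‖ :=
  Submodule.norm_starProjection_apply_le _ x

theorem spectralProj_resolvent (hG : IsPositiveOperator G) (n : ℕ) (x : H) :
    spectralProj G n (resolvent G x) = resolvent G (spectralProj G n x) := by
  refine starProjection_apply_comm (resolvent_isSymmetric hG) (fun y hy => ?_) x
  have h : Commute (cfc (fun r : ℝ => max (1 / ((n : ℝ) + 1) - r) 0) (resolvent G))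
      (resolvent G) := ((Commute.refl (resolvent G)).cfc_real _)
  have h1 := congrArg (fun T : H →L[ℂ] H => T y) h.eq
  change cfc (fun r : ℝ => max (1 / ((n : ℝ) + 1) - r) 0) (resolvent G) y = 0 at hy
  change cfc (fun r : ℝ => max (1 / ((n : ℝ) + 1) - r) 0) (resolvent G) (resolvent G y) = 0
  refine h1.trans ?_
  change resolvent G (cfc (fun r : ℝ => max (1 / ((n : ℝ) + 1) - r) 0) (resolvent G) y) = 0
  rw [hy, map_zero]

/-- `P_n` commutes with the injective resolvent `R`, and `R (P_n x + G P_n x) = P_n x`. Applying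
`P_n` and cancelling `R` leaves the claim. -/
theorem spectralProj_truncOp (hG : IsPositiveOperator G) (n : ℕ) (x : H) :
    spectralProj G n (truncOp G n x) = truncOp G n x := by
  have h1 := (mem_graph_iff_resolvent hG _).1 (truncOp_mem_graph hG n x)
  dsimp only at h1
  have h2 := congrArg (spectralProj G n) h1
  rw [spectralProj_resolvent hG, spectralProj_idem, ← h1, ← sub_eq_zero, ← map_sub] at h2
  have h3 := resolvent_injective hG h2
  rw [h1, map_add, spectralProj_idem] at h3
  rw [add_sub_add_left_eq_sub, sub_eq_zero] at h3
  exact h3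

theorem inner_truncOp (hG : IsPositiveOperator G) (n : ℕ) (x : H) :
    inner ℂ x (truncOp G n x) = inner ℂ (spectralProj G n x) (truncOp G n x) := by
  rw [spectralProj_inner_symm, spectralProj_truncOp hG]

theorem exists_mem_graph_truncOp (hG : IsPositiveOperator G) (n : ℕ) (x : H) :
    ∃ η, (spectralProj G n x, η) ∈ (sqrtOp G).graph ∧ (η, truncOp G n x) ∈ (sqrtOp G).graph ∧
      (inner ℂ x (truncOp G n x)).re = ‖η‖ ^ 2 := by
  rw [inner_truncOp hG]
  exact exists_mem_graph_sqrtOp hG (truncOp_mem_graph hG n x)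

/-- With `η' = √G P_n x`, moving one `√G` across gives `⟨η, η'⟩ = ⟨x, G P_n x⟩`, whose real part is
`‖η'‖²`; by Cauchy–Schwarz `‖η'‖ ≤ ‖η‖`. -/
theorem re_inner_truncOp_le (hG : IsPositiveOperator G) (n : ℕ) {x η : H}
    (h : (x, η) ∈ (sqrtOp G).graph) : (inner ℂ x (truncOp G n x)).re ≤ ‖η‖ ^ 2 := by
  obtain ⟨η', -, h2, h3⟩ := exists_mem_graph_truncOp hG n x
  have h4 := inner_graph_symm (isSqrt_sqrtOp hG).1 h h2
  dsimp only at h4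
  have h5 := (Complex.re_le_norm _).trans (norm_inner_le_norm (𝕜 := ℂ) η η')
  rw [h4, h3] at h5
  rw [h3]
  nlinarith [norm_nonneg η, norm_nonneg η', sq_nonneg (‖η‖ - ‖η'‖)]

/-- `P_n` projects onto the part where `R ≥ c = 1 / (n + 1)`, so what it removes from `R w` has size
at most `c ‖w‖`. -/
theorem norm_resolvent_sub_spectralProj_le (hG : IsPositiveOperator G) (n : ℕ) (w : H) :
    ‖resolvent G w - spectralProj G n (resolvent G w)‖ ≤ 1 / ((n : ℝ) + 1) * ‖w‖ := by
  have hsa : IsSelfAdjoint (resolvent G) := IsSelfAdjoint.of_nonneg (resolvent_nonneg hG)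
  set c : ℝ := 1 / ((n : ℝ) + 1) with hc
  have hc0 : 0 < c := by positivity
  -- `(R - c)₊ w` lies in the range of `P_n` since `(c - R)₊ (R - c)₊ = 0`, and it differs from `R
  -- w` by `min(R, c) w`. The projection, being the nearest point, does no worse.
  set D : H →L[ℂ] H := cfc (fun r : ℝ => max (r - c) 0) (resolvent G) with hD
  have hmem : D w ∈ (cfc (fun r : ℝ => max (c - r) 0) (resolvent G) : H →L[ℂ] H).ker := by
    have h1 : cfc (fun r : ℝ => max (c - r) 0) (resolvent G) * D = 0 := by
      rw [hD, ← cfc_mul _ _ (resolvent G) (by fun_prop) (by fun_prop),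
        ← cfc_const_zero ℝ (resolvent G)]
      refine cfc_congr fun r _ => ?_
      rcases le_total c r with hr | hr
      · simp [max_eq_right (sub_nonpos.2 hr)]
      · simp [max_eq_right (sub_nonpos.2 hr)]
    exact congrArg (fun T : H →L[ℂ] H => T w) h1
  have hle : ‖resolvent G - D‖ ≤ c := by
    have h1 : resolvent G - D = cfc (fun r : ℝ => r - max (r - c) 0) (resolvent G) := by
      rw [cfc_sub (fun r : ℝ => r) (fun r : ℝ => max (r - c) 0) (resolvent G) (by fun_prop)
        (by fun_prop), cfc_id' ℝ (resolvent G) hsa]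
    rw [h1]
    refine norm_cfc_le hc0.le fun r hr => ?_
    have hr0 : 0 ≤ r := spectrum_nonneg_of_nonneg (resolvent_nonneg hG) hr
    rw [Real.norm_eq_abs, abs_le]
    rcases le_total c r with h | h
    · rw [max_eq_left (sub_nonneg.2 h)]; constructor <;> linarith
    · rw [max_eq_right (sub_nonpos.2 h)]; constructor <;> linarith
  have h2 : ‖resolvent G w - spectralProj G n (resolvent G w)‖ ≤ ‖resolvent G w - D w‖ := by
    rw [spectralProj, Submodule.starProjection_minimal]
    exact ciInf_le ⟨0, by rintro _ ⟨x, rfl⟩; exact norm_nonneg _⟩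
      (⟨D w, hmem⟩ : (cfc (fun r : ℝ => max (c - r) 0) (resolvent G) : H →L[ℂ] H).ker)
  exact h2.trans ((resolvent G - D).le_of_opNorm_le hle w)

theorem dense_range_resolvent (hG : IsPositiveOperator G) :
    DenseRange (resolvent G) := by
  have : Dense (((resolvent G).range : Submodule ℂ H) : Set H) := by
    rw [Submodule.dense_iff_topologicalClosure_eq_top,
      Submodule.topologicalClosure_eq_top_iff, Submodule.eq_bot_iff]
    intro x hx
    refine resolvent_injective hG (ext_inner_right ℂ fun y => ?_)
    rw [resolvent_isSymmetric hG, inner_zero_left]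
    exact (Submodule.mem_orthogonal' _ _).1 hx _ ⟨y, rfl⟩
  exact this

open Filter Topology in
-- Convergence on the dense range of the resolvent extends to all vectors because the projections
-- are contractions.
theorem tendsto_spectralProj (hG : IsPositiveOperator G) (x : H) :
    Tendsto (fun n => spectralProj G n x) atTop (𝓝 x) := by
  rw [Metric.tendsto_atTop]
  intro ε hε
  obtain ⟨w, hw⟩ := (dense_range_resolvent hG).exists_dist_lt x (ε := ε / 3) (by positivity)
  have hlim : Tendsto (fun n : ℕ => 1 / ((n : ℝ) + 1) * ‖w‖) atTop (𝓝 0) := by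
    simpa using (tendsto_one_div_add_atTop_nhds_zero_nat (𝕜 := ℝ)).mul_const ‖w‖
  obtain ⟨N, hN⟩ := (hlim.eventually (gt_mem_nhds (show 0 < ε / 3 by positivity))).exists_forall_of_atTop
  refine ⟨N, fun n hn => ?_⟩
  have h1 := norm_resolvent_sub_spectralProj_le hG n w
  have h2 := norm_spectralProj_apply_le G n (x - resolvent G w)
  rw [dist_eq_norm] at hw ⊢
  have h3 : spectralProj G n x - x = spectralProj G n (x - resolvent G w)
      - (x - resolvent G w) - (resolvent G w - spectralProj G n (resolvent G w)) := by
    rw [map_sub]; abel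
  rw [h3]
  have := norm_sub_le (spectralProj G n (x - resolvent G w) - (x - resolvent G w))
    (resolvent G w - spectralProj G n (resolvent G w))
  have h5 := norm_sub_le (spectralProj G n (x - resolvent G w)) (x - resolvent G w)
  linarith [hN n hn]

end SpectralProj

/-! ### Hilbert–Schmidt operators, trace and trace norm -/

section HilbertSchmidt

variable {H : Type*} [NormedAddCommGroup H] [InnerProductSpace ℂ H] [CompleteSpace H]

/-- The square of the Hilbert–Schmidt norm, in `[0, ∞]`. -/
noncomputable def hsSq (X : H →L[ℂ] H) : ENNReal := ∑' i, ENNReal.ofReal (‖X (basis H i)‖ ^ 2)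

theorem norm_basis (i : basisIndex H) : ‖basis H i‖ = 1 := (basis H).orthonormal.1 i

theorem hasSum_norm_inner_sq (x : H) :
    HasSum (fun i => ‖inner ℂ (basis H i) x‖ ^ 2) (‖x‖ ^ 2) := by
  have h := Complex.hasSum_re ((basis H).hasSum_inner_mul_inner x x)
  rw [re_inner_self] at h
  convert h using 2 with i
  rw [← inner_conj_symm x, ← Complex.normSq_eq_conj_mul_self, Complex.ofReal_re,
    Complex.normSq_eq_norm_sq]

theorem tsum_ofReal_norm_inner_sq (x : H) :
    ∑' i, ENNReal.ofReal (‖inner ℂ (basis H i) x‖ ^ 2) = ENNReal.ofReal (‖x‖ ^ 2) := by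
  rw [← ENNReal.ofReal_tsum_of_nonneg (fun i => by positivity) (hasSum_norm_inner_sq x).summable,
    (hasSum_norm_inner_sq x).tsum_eq]

theorem hsSq_star (X : H →L[ℂ] H) : hsSq (star X) = hsSq X := by
  have h : ∀ Y : H →L[ℂ] H, hsSq Y =
      ∑' i, ∑' j, ENNReal.ofReal (‖inner ℂ (basis H j) (Y (basis H i))‖ ^ 2) := fun Y =>
    tsum_congr fun i => (tsum_ofReal_norm_inner_sq _).symm
  rw [h, h, ENNReal.tsum_comm]
  refine tsum_congr fun i => tsum_congr fun j => ?_
  rw [inner_star_right, norm_inner_symm]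

theorem hsSq_mul_le (C X : H →L[ℂ] H) : hsSq (C * X) ≤ ENNReal.ofReal (‖C‖ ^ 2) * hsSq X := by
  rw [hsSq, hsSq, ← ENNReal.tsum_mul_left]
  refine ENNReal.tsum_le_tsum fun i => ?_
  rw [← ENNReal.ofReal_mul (by positivity), ← mul_pow]
  exact ENNReal.ofReal_le_ofReal
    (pow_le_pow_left₀ (norm_nonneg _) (C.le_opNorm (X (basis H i))) 2)

theorem hsSq_mul_ne_top (C : H →L[ℂ] H) {X : H →L[ℂ] H} (hX : hsSq X ≠ ⊤) : hsSq (C * X) ≠ ⊤ :=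
  ((hsSq_mul_le C X).trans_lt (ENNReal.mul_lt_top ENNReal.ofReal_lt_top hX.lt_top)).ne

theorem hsSq_mul_le_of_norm_le_one {C : H →L[ℂ] H} (hC : ‖C‖ ≤ 1) (X : H →L[ℂ] H) :
    hsSq (C * X) ≤ hsSq X := by
  refine (hsSq_mul_le C X).trans ?_
  have : ENNReal.ofReal (‖C‖ ^ 2) ≤ 1 := by
    rw [ENNReal.ofReal_le_one]; exact pow_le_one₀ (norm_nonneg _) hC
  exact (mul_le_mul_left this _).trans_eq (one_mul _)

theorem hasSum_norm_sq {X : H →L[ℂ] H} (hX : hsSq X ≠ ⊤) :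
    HasSum (fun i => ‖X (basis H i)‖ ^ 2) (hsSq X).toReal := by
  have h := ENNReal.hasSum_toReal hX
  rw [← ENNReal.tsum_toReal_eq (fun _ => ENNReal.ofReal_ne_top)] at h
  convert h using 2 with i
  · exact (ENNReal.toReal_ofReal (sq_nonneg _)).symm
  · rfl

theorem sum_norm_mul_norm_le {X Y : H →L[ℂ] H} (hX : hsSq X ≠ ⊤) (hY : hsSq Y ≠ ⊤)
    (F : Finset (basisIndex H)) :
    ∑ i ∈ F, ‖X (basis H i)‖ * ‖Y (basis H i)‖ ≤ √(hsSq X).toReal * √(hsSq Y).toReal := by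
  rw [← Real.sqrt_mul ENNReal.toReal_nonneg]
  refine Real.le_sqrt_of_sq_le ((Finset.sum_mul_sq_le_sq_mul_sq _ _ _).trans ?_)
  refine mul_le_mul ?_ ?_ (Finset.sum_nonneg fun _ _ => by positivity) ENNReal.toReal_nonneg
  · exact sum_le_hasSum _ (fun _ _ => by positivity) (hasSum_norm_sq hX)
  · exact sum_le_hasSum _ (fun _ _ => by positivity) (hasSum_norm_sq hY)

theorem summable_inner_apply {X Y : H →L[ℂ] H} (hX : hsSq X ≠ ⊤) (hY : hsSq Y ≠ ⊤) :
    Summable fun i => inner ℂ (X (basis H i)) (Y (basis H i)) :=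
  Summable.of_norm (summable_of_sum_le (fun _ => norm_nonneg _) fun F =>
    (Finset.sum_le_sum fun _ _ => norm_inner_le_norm (𝕜 := ℂ) _ _).trans
      (sum_norm_mul_norm_le hX hY F))

theorem summable_matrix_norm_sq {X : H →L[ℂ] H} (hX : hsSq X ≠ ⊤) :
    Summable fun p : basisIndex H × basisIndex H =>
      ‖inner ℂ (basis H p.2) (X (basis H p.1))‖ ^ 2 := by
  rw [summable_prod_of_nonneg (fun _ => by positivity)]
  refine ⟨fun i => (hasSum_norm_inner_sq (X (basis H i))).summable, ?_⟩
  simp only [(hasSum_norm_inner_sq _).tsum_eq]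
  exact (hasSum_norm_sq hX).summable

theorem trace_mul_eq_tsum (X Y : H →L[ℂ] H) :
    trace (X * Y) =
      ∑' i, ∑' j, inner ℂ (basis H i) (X (basis H j)) * inner ℂ (basis H j) (Y (basis H i)) := by
  refine tsum_congr fun i => ?_
  simp only [← inner_star_left X]
  rw [(basis H).tsum_inner_mul_inner, inner_star_left]
  rfl

/-- Both traces are the same double sum over matrix entries in opposite orders. It converges
absolutely, as `|ab| ≤ |a|² + |b|²` and the entries of `X` and `Y` are square summable. -/
theorem trace_mul_comm {X Y : H →L[ℂ] H} (hX : hsSq X ≠ ⊤) (hY : hsSq Y ≠ ⊤) :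
    trace (X * Y) = trace (Y * X) := by
  rw [trace_mul_eq_tsum, trace_mul_eq_tsum, Summable.tsum_comm]
  · simp only [mul_comm]
  · refine Summable.of_norm_bounded
      ((summable_matrix_norm_sq hX).add (summable_matrix_norm_sq hY).prod_symm) ?_
    rintro ⟨j, i⟩
    simp only [Function.uncurry, Prod.swap, norm_mul]
    nlinarith [sq_nonneg (‖inner ℂ (basis H i) (X (basis H j))‖
      - ‖inner ℂ (basis H j) (Y (basis H i))‖),
      sq_nonneg ‖inner ℂ (basis H i) (X (basis H j))‖,
      sq_nonneg ‖inner ℂ (basis H j) (Y (basis H i))‖]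

theorem trace_star_mul_self (X : H →L[ℂ] H) : trace (star X * X) = ((hsSq X).toReal : ℂ) := by
  rw [hsSq, ENNReal.tsum_toReal_eq (fun _ => ENNReal.ofReal_ne_top), Complex.ofReal_tsum]
  refine tsum_congr fun i => ?_
  rw [ENNReal.toReal_ofReal (by positivity)]
  change inner ℂ (basis H i) (star X (X (basis H i))) = _
  rw [inner_star_right, inner_self_eq_norm_sq_to_K]
  push_cast; rfl

theorem traceNorm_eq_hsSq {ρ : H →L[ℂ] H} (hρ : 0 ≤ ρ) : traceNorm ρ = hsSq (CFC.sqrt ρ) := by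
  rw [traceNorm, hsSq, CFC.abs_of_nonneg ρ hρ]
  refine tsum_congr fun i => ?_
  congr 1
  rw [← re_inner_self, inner_symm_of_nonneg (CFC.sqrt_nonneg ρ)]
  congr 2
  exact congrArg (fun T : H →L[ℂ] H => T (basis H i)) (CFC.sqrt_mul_sqrt_self ρ hρ).symm

theorem star_sqrt_mul_sqrt {ρ : H →L[ℂ] H} (hρ : 0 ≤ ρ) :
    star (CFC.sqrt ρ) * CFC.sqrt ρ = ρ := by
  rw [(IsSelfAdjoint.of_nonneg (CFC.sqrt_nonneg ρ)).star_eq, CFC.sqrt_mul_sqrt_self ρ hρ]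

theorem IsSubState.hsSq_sqrt_le_one {ρ : H →L[ℂ] H} (h : IsSubState ρ) :
    hsSq (CFC.sqrt ρ) ≤ 1 := by
  have h1 := trace_star_mul_self (CFC.sqrt ρ)
  rw [star_sqrt_mul_sqrt h.nonneg] at h1
  have h2 := h.trace_le
  rw [h1, Complex.ofReal_re] at h2
  have h3 : hsSq (CFC.sqrt ρ) ≠ ⊤ := by
    rw [← traceNorm_eq_hsSq h.nonneg]; exact h.traceClass
  rw [← ENNReal.ofReal_toReal h3]
  exact ENNReal.ofReal_le_one.2 h2

theorem trace_mul_rankOne (B : H →L[ℂ] H) (x y : H) :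
    trace (B * InnerProductSpace.rankOne ℂ x y) = inner ℂ y (B x) := by
  rw [← (basis H).tsum_inner_mul_inner y (B x)]
  refine tsum_congr fun i => ?_
  change inner ℂ (basis H i) (B (inner ℂ y (basis H i) • x)) = _
  rw [map_smul, inner_smul_right]

theorem trace_rankOne_mul (B : H →L[ℂ] H) (x y : H) :
    trace (InnerProductSpace.rankOne ℂ x y * B) = inner ℂ y (B x) := by
  rw [← inner_star_left, ← (basis H).tsum_inner_mul_inner (star B y) x]
  refine tsum_congr fun i => ?_
  change inner ℂ (basis H i) (inner ℂ y (B (basis H i)) • x) = _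
  rw [inner_smul_right, inner_star_left]

/-- An approximate polar decomposition. -/
theorem exists_approx_polar (T : H →L[ℂ] H) {ε : ℝ} (hε : 0 < ε) :
    ∃ V : H →L[ℂ] H, ‖V‖ ≤ 1 ∧ (∀ x, ‖CFC.abs T x - star V (T x)‖ ≤ ε * ‖x‖) ∧
      ∀ x, ‖T x - V (CFC.abs T x)‖ ≤ ε * ‖x‖ := by
  set K := CFC.abs T with hK
  have hK0 : 0 ≤ K := CFC.abs_nonneg T
  have hunit : IsUnit (K + algebraMap ℝ (H →L[ℂ] H) ε) := by
    have h1 : -ε ∉ spectrum ℝ K := fun h => by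
      have := spectrum_nonneg_of_nonneg hK0 h; linarith
    rw [spectrum.notMem_iff] at h1
    have h2 := h1.neg
    rwa [map_neg, neg_sub, sub_neg_eq_add] at h2
  obtain ⟨u, hu⟩ := hunit
  -- The approximate partial isometry is `V = T (|T| + ε)⁻¹`. The errors are then `|T| - V*T = ε |T|
  -- W` and `T - V|T| = ε T W`.
  set W : H →L[ℂ] H := ↑u⁻¹ with hW
  have hKW : (K + algebraMap ℝ (H →L[ℂ] H) ε) * W = 1 := by rw [← hu]; exact u.mul_inv
  have hWK : W * (K + algebraMap ℝ (H →L[ℂ] H) ε) = 1 := by rw [← hu]; exact u.inv_mul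
  have hKx : ∀ x, K (W x) + (ε : ℂ) • W x = x := fun x => by
    have := congrArg (fun S : H →L[ℂ] H => S x) hKW
    rw [Algebra.algebraMap_eq_smul_one] at this
    rw [Complex.coe_smul]; exact this
  have hWx : ∀ x, W (K x) + (ε : ℂ) • W x = x := fun x => by
    have := congrArg (fun S : H →L[ℂ] H => S x) hWK
    rw [Algebra.algebraMap_eq_smul_one] at this
    change W (K x + ε • x) = x at this
    rwa [← Complex.coe_smul, map_add, map_smul] at this
  have hcomm : ∀ x, W (K x) = K (W x) := fun x =>
    add_right_cancel ((hWx x).trans (hKx x).symm)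
  -- Since `K ≥ 0`, the cross term in `‖K y + ε y‖²` is nonnegative; so `‖T y‖ = ‖K y‖ ≤ ‖(K + ε)
  -- y‖`, used with `y = W x`.
  have hTW : ∀ x, ‖T (W x)‖ ≤ ‖x‖ := by
    intro x
    rw [← norm_abs_apply, ← hK]
    refine (pow_le_pow_iff_left₀ (norm_nonneg _) (norm_nonneg _) two_ne_zero).1 ?_
    conv_rhs => rw [← hKx x]
    have h1 := norm_add_sq (𝕜 := ℂ) (K (W x)) ((ε : ℂ) • W x)
    rw [h1, inner_smul_right]
    have h2 := re_inner_nonneg_of_nonneg hK0 (W x)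
    rw [← inner_symm_of_nonneg hK0] at h2
    have h3 : 0 ≤ RCLike.re ((ε : ℂ) * inner ℂ (K (W x)) (W x)) := by
      change 0 ≤ ((ε : ℂ) * inner ℂ (K (W x)) (W x)).re
      rw [Complex.re_ofReal_mul]; positivity
    nlinarith [sq_nonneg ‖(ε : ℂ) • W x‖]
  have hWs : star W = W := by
    have hs : star (K + algebraMap ℝ (H →L[ℂ] H) ε) = K + algebraMap ℝ (H →L[ℂ] H) ε := by
      rw [star_add, (IsSelfAdjoint.of_nonneg hK0).star_eq, ← algebraMap_star_comm]; simp
    have h1 := congrArg star hKW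
    rw [star_mul, hs, star_one] at h1
    calc star W = star W * ((K + algebraMap ℝ (H →L[ℂ] H) ε) * W) := by rw [hKW, mul_one]
      _ = W := by rw [← mul_assoc, h1, one_mul]
  have hn : ∀ y : H, ‖(ε : ℂ) • y‖ = ε * ‖y‖ := fun y => by
    rw [norm_smul, Complex.norm_real, Real.norm_of_nonneg hε.le]
  refine ⟨T * W, ContinuousLinearMap.opNorm_le_bound _ zero_le_one fun x => by
    rw [one_mul]; exact hTW x, fun x => ?_, fun x => ?_⟩
  · have h1 : star (T * W) (T x) = W (K (K x)) := by
      have h2 : star (T * W) * T = W * (K * K) := by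
        rw [star_mul, hWs, hK, CFC.abs_mul_abs, mul_assoc]
      exact congrArg (fun S : H →L[ℂ] H => S x) h2
    have h3 : K x - W (K (K x)) = (ε : ℂ) • K (W x) := by
      conv_lhs => enter [1]; rw [← hWx (K x)]
      rw [add_sub_cancel_left, hcomm]
    rw [h1, h3, hn, hK, norm_abs_apply]
    exact mul_le_mul_of_nonneg_left (hTW x) hε.le
  · have h3 : T x - (T * W) (K x) = (ε : ℂ) • T (W x) := by
      change T x - T (W (K x)) = _
      conv_lhs => enter [1]; rw [← hWx x]
      rw [map_add, add_sub_cancel_left, map_smul]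
    rw [h3, hn]
    exact mul_le_mul_of_nonneg_left (hTW x) hε.le

/-- Cauchy–Schwarz: up to a small error `⟨e, |XY| e⟩` is `⟨X*V e, Y e⟩`, and multiplication by the
contraction `V` does not increase the Hilbert–Schmidt norm of `X*`. -/
theorem traceNorm_mul_le {X Y : H →L[ℂ] H} (hX : hsSq X ≠ ⊤) (hY : hsSq Y ≠ ⊤) :
    traceNorm (X * Y) ≤ ENNReal.ofReal (√(hsSq X).toReal * √(hsSq Y).toReal) := by
  rw [traceNorm, ENNReal.tsum_eq_iSup_sum]
  refine iSup_le fun F => ?_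
  have hpos : ∀ i, 0 ≤ (inner ℂ (basis H i) (CFC.abs (X * Y) (basis H i))).re := fun i =>
    re_inner_nonneg_of_nonneg (CFC.abs_nonneg (X * Y)) (basis H i)
  rw [← ENNReal.ofReal_sum_of_nonneg fun i _ => hpos i]
  refine ENNReal.ofReal_le_ofReal (le_of_forall_pos_le_add fun ε hε => ?_)
  -- The tolerance is divided by more than the number of terms, so the errors over `F` add up to at
  -- most `ε`.
  obtain ⟨V, hV, hVT, -⟩ := exists_approx_polar (X * Y) (ε := ε / (F.card + 1)) (by positivity)
  have hXV : hsSq (star X * V) ≤ hsSq X := by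
    rw [← hsSq_star, star_mul, star_star]
    exact hsSq_mul_le_of_norm_le_one (by rwa [norm_star]) X
  have hXV' : hsSq (star X * V) ≠ ⊤ := (hXV.trans_lt hX.lt_top).ne
  have hterm : ∀ i, (inner ℂ (basis H i) (CFC.abs (X * Y) (basis H i))).re ≤
      ‖(star X * V) (basis H i)‖ * ‖Y (basis H i)‖ + ε / (F.card + 1) := by
    intro i
    set e := basis H i with he
    have hn : ‖e‖ = 1 := norm_basis i
    have h1 : inner ℂ e (CFC.abs (X * Y) e) = inner ℂ ((star X * V) e) (Y e)
        + inner ℂ e (CFC.abs (X * Y) e - star V ((X * Y) e)) := by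
      have : inner ℂ ((star X * V) e) (Y e) = inner ℂ e (star V ((X * Y) e)) := by
        rw [inner_star_right]
        exact inner_star_left X _ _
      rw [this, inner_sub_right]; ring
    rw [h1, Complex.add_re]
    refine add_le_add ((Complex.re_le_norm _).trans (norm_inner_le_norm (𝕜 := ℂ) _ _)) ?_
    refine ((Complex.re_le_norm _).trans (norm_inner_le_norm (𝕜 := ℂ) _ _)).trans ?_
    rw [hn, one_mul]
    have := hVT e
    rwa [hn, mul_one] at this
  refine (Finset.sum_le_sum fun i _ => hterm i).trans ?_
  rw [Finset.sum_add_distrib, Finset.sum_const, nsmul_eq_mul]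
  refine add_le_add ((sum_norm_mul_norm_le hXV' hY F).trans ?_) ?_
  · gcongr
  · rw [mul_div_assoc', div_le_iff₀ (by positivity)]
    nlinarith

/-- Write `T ≈ V|T| = V S S` with `S = |T|^{1/2}`. The diagonal entries become `⟨S V* e, S e⟩`, and
Cauchy–Schwarz bounds their sum by the squared Hilbert–Schmidt norm of `S`, which is the trace norm
of `T`. -/
theorem norm_trace_le {T : H →L[ℂ] H} (hT : IsTraceClass T) :
    ‖trace T‖ ≤ (traceNorm T).toReal := by
  set S := CFC.sqrt (CFC.abs T) with hS
  have hS0 : 0 ≤ S := CFC.sqrt_nonneg _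
  have hSS : ∀ x, S (S x) = CFC.abs T x := fun x =>
    congrArg (fun R : H →L[ℂ] H => R x) (CFC.sqrt_mul_sqrt_self (CFC.abs T) (CFC.abs_nonneg T))
  have hTS : traceNorm T = hsSq S := by
    rw [hS, ← traceNorm_eq_hsSq (CFC.abs_nonneg T), traceNorm, traceNorm,
      CFC.abs_of_nonneg _ (CFC.abs_nonneg T)]
  have hSt : hsSq S ≠ ⊤ := by rw [← hTS]; exact hT
  have hfin : ∀ F : Finset (basisIndex H),
      ∑ i ∈ F, ‖inner ℂ (basis H i) (T (basis H i))‖ ≤ (traceNorm T).toReal := by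
    intro F
    refine le_of_forall_pos_le_add fun ε hε => ?_
    obtain ⟨V, hV, -, hVT⟩ := exists_approx_polar T (ε := ε / (F.card + 1)) (by positivity)
    have hSV : hsSq (S * star V) ≤ hsSq S := by
      rw [← hsSq_star, star_mul, star_star, (IsSelfAdjoint.of_nonneg hS0).star_eq]
      exact hsSq_mul_le_of_norm_le_one hV S
    have hSV' : hsSq (S * star V) ≠ ⊤ := (hSV.trans_lt hSt.lt_top).ne
    have hterm : ∀ i, ‖inner ℂ (basis H i) (T (basis H i))‖ ≤
        ‖(S * star V) (basis H i)‖ * ‖S (basis H i)‖ + ε / (F.card + 1) := by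
      intro i
      set e := basis H i with he
      have hn : ‖e‖ = 1 := norm_basis i
      have h1 : inner ℂ e (T e) = inner ℂ ((S * star V) e) (S e)
          + inner ℂ e (T e - V (CFC.abs T e)) := by
        have : inner ℂ ((S * star V) e) (S e) = inner ℂ e (V (CFC.abs T e)) := by
          rw [← hSS, ← inner_star_left V]
          exact inner_symm_of_nonneg hS0 _ _
        rw [this, inner_sub_right]; ring
      rw [h1]
      refine (norm_add_le _ _).trans (add_le_add (norm_inner_le_norm (𝕜 := ℂ) _ _) ?_)
      refine (norm_inner_le_norm (𝕜 := ℂ) _ _).trans ?_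
      rw [hn, one_mul]
      have := hVT e
      rwa [hn, mul_one] at this
    refine (Finset.sum_le_sum fun i _ => hterm i).trans ?_
    rw [Finset.sum_add_distrib, Finset.sum_const, nsmul_eq_mul]
    refine add_le_add ((sum_norm_mul_norm_le hSV' hSt F).trans ?_) ?_
    · rw [hTS]
      conv_rhs => rw [← Real.mul_self_sqrt (ENNReal.toReal_nonneg (a := hsSq S))]
      gcongr
    · rw [mul_div_assoc', div_le_iff₀ (by positivity)]
      nlinarith
  have hsum : Summable fun i => ‖inner ℂ (basis H i) (T (basis H i))‖ :=
    summable_of_sum_le (fun _ => norm_nonneg _) hfin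
  exact (norm_tsum_le_tsum_norm hsum).trans (hsum.tsum_le_of_sum_le hfin)

end HilbertSchmidt

/-! ### From vectors to substates -/

section Substates

variable {H : Type*} [NormedAddCommGroup H] [InnerProductSpace ℂ H] [CompleteSpace H]
  {G : H →ₗ.[ℂ] H}

/-- Cyclicity turns `Tr G P_n σ` into a sum over the vectors `√σ e_i` with nonnegative terms, so
every partial sum obeys the energy bound. -/
theorem sum_re_inner_truncOp_le (hG : IsPositiveOperator G) {σ : H →L[ℂ] H} (hσ : 0 ≤ σ)
    (hS : hsSq (CFC.sqrt σ) ≠ ⊤) {Y : ℝ} (hY : 0 ≤ Y)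
    (hσY : traceEnergy G σ ≤ ENNReal.ofReal Y) (n : ℕ) (F : Finset (basisIndex H)) :
    ∑ i ∈ F, (inner ℂ (CFC.sqrt σ (basis H i)) (truncOp G n (CFC.sqrt σ (basis H i)))).re ≤ Y := by
  set S := CFC.sqrt σ with hSdef
  have hS0 : 0 ≤ S := CFC.sqrt_nonneg _
  have hSS : S * S = σ := CFC.sqrt_mul_sqrt_self σ hσ
  have hTS : hsSq (truncOp G n * S) ≠ ⊤ := hsSq_mul_ne_top _ hS
  have h1 : trace (truncOp G n * σ) =
      ∑' i, inner ℂ (S (basis H i)) ((truncOp G n * S) (basis H i)) := by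
    rw [← hSS, ← mul_assoc, trace_mul_comm hTS hS]
    exact tsum_congr fun i => (inner_symm_of_nonneg hS0 _ _).symm
  have hsum := summable_inner_apply hS hTS
  have h2 : (trace (truncOp G n * σ)).re ≤ Y := by
    have h3 := (le_iSup (fun n : ℕ => ENNReal.ofReal (trace (truncOp G n * σ)).re) n).trans hσY
    exact (ENNReal.ofReal_le_ofReal_iff hY).1 h3
  rw [h1, Complex.re_tsum hsum] at h2
  refine le_trans ?_ h2
  refine (Complex.hasSum_re hsum.hasSum).summable.sum_le_tsum F fun i _ => ?_
  obtain ⟨η, -, -, h4⟩ := exists_mem_graph_truncOp hG n (S (basis H i))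
  change 0 ≤ (inner ℂ (S (basis H i)) (truncOp G n (S (basis H i)))).re
  rw [h4]; positivity

/-- The E-norm controls `Tr A σ A*` on the substates `σ` with `Tr G σ ≤ Y`. -/
theorem hsSq_mul_sqrt_le (hG : IsPositiveOperator G) (h0 : HasZeroInf G) {σ : H →L[ℂ] H}
    (hσ : 0 ≤ σ) (hS : hsSq (CFC.sqrt σ) ≤ 1) {Y : ℝ} (hY : 0 ≤ Y)
    (hσY : traceEnergy G σ ≤ ENNReal.ofReal Y) (A : H →L[ℂ] H) :
    hsSq (A * CFC.sqrt σ) ≤ ENNReal.ofReal (opENorm G Y A ^ 2) := by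
  have hS' : hsSq (CFC.sqrt σ) ≠ ⊤ := (hS.trans_lt ENNReal.one_lt_top).ne
  have hen := sum_re_inner_truncOp_le hG hσ hS' hY hσY
  set S := CFC.sqrt σ with hSdef
  have hnorm : ∀ F : Finset (basisIndex H), ∑ i ∈ F, ‖S (basis H i)‖ ^ 2 ≤ 1 := fun F =>
    (sum_le_hasSum F (fun _ _ => by positivity) (hasSum_norm_sq hS')).trans
      (ENNReal.toReal_le_of_le_ofReal zero_le_one (by simpa using hS))
  have hproj : ∀ n i, ‖spectralProj G n (S (basis H i))‖ ^ 2 ≤ ‖S (basis H i)‖ ^ 2 := fun n i =>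
    pow_le_pow_left₀ (norm_nonneg _) (norm_spectralProj_apply_le G n _) 2
  rw [hsSq, ENNReal.tsum_eq_iSup_sum]
  refine iSup_le fun F => ?_
  rw [← ENNReal.ofReal_sum_of_nonneg fun i _ => sq_nonneg _]
  refine ENNReal.ofReal_le_ofReal ?_
  -- The multiplier inequality needs vectors in the domain of `√G`. Truncation by `P_n` supplies
  -- them, and for a finite sum the limit in `n` is harmless.
  have hlim : Filter.Tendsto
      (fun n => ∑ i ∈ F, ‖A (spectralProj G n (S (basis H i)))‖ ^ 2) Filter.atTop
      (nhds (∑ i ∈ F, ‖(A * S) (basis H i)‖ ^ 2)) :=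
    tendsto_finsetSum _ fun i _ =>
      ((A.continuous.tendsto _).comp (tendsto_spectralProj hG (S (basis H i)))).norm.pow 2
  refine le_of_tendsto' hlim fun n => ?_
  -- No multiplier is available at level `0`; there each `P_n √σ e_i` lies in the kernel of `√G`.
  rcases hY.eq_or_lt with rfl | hY
  · have hterm : ∀ i ∈ F, ‖A (spectralProj G n (S (basis H i)))‖ ^ 2 ≤
        opENorm G 0 A ^ 2 * ‖S (basis H i)‖ ^ 2 := by
      intro i _
      obtain ⟨η, h1, -, h2⟩ := exists_mem_graph_truncOp hG n (S (basis H i))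
      have h3 := hen n {i}
      rw [Finset.sum_singleton, h2] at h3
      have h4 : η = 0 := by
        rw [← norm_eq_zero, ← pow_eq_zero_iff two_ne_zero]
        exact le_antisymm h3 (sq_nonneg _)
      rw [h4] at h1
      exact (norm_sq_le_of_mem_graph_zero A h1).trans
        (mul_le_mul_of_nonneg_left (hproj n i) (sq_nonneg _))
    refine (Finset.sum_le_sum hterm).trans ?_
    rw [← Finset.mul_sum]
    exact mul_le_of_le_one_right (sq_nonneg _) (hnorm F)
  · obtain ⟨μ, k, hμ, hk, hE, hm⟩ := exists_multiplier_opENorm hG h0 hY A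
    have hterm : ∀ i ∈ F, ‖A (spectralProj G n (S (basis H i)))‖ ^ 2 ≤
        μ * ‖S (basis H i)‖ ^ 2 +
          k * (inner ℂ (S (basis H i)) (truncOp G n (S (basis H i)))).re := by
      intro i _
      obtain ⟨η, h1, -, h2⟩ := exists_mem_graph_truncOp hG n (S (basis H i))
      rw [h2]
      exact (hm _ _ h1).trans (add_le_add (mul_le_mul_of_nonneg_left (hproj n i) hμ) le_rfl)
    refine (Finset.sum_le_sum hterm).trans ?_
    rw [Finset.sum_add_distrib, ← Finset.mul_sum, ← Finset.mul_sum, ← hE]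
    -- Trace at most one is enough because `μ ≥ 0`, and an energy bound is enough because `k ≥ 0`.
    nlinarith [mul_le_mul_of_nonneg_left (hnorm F) hμ, mul_le_mul_of_nonneg_left (hen n F) hk]

theorem IsSubState.traceNorm_mul_mul_star_le (hG : IsPositiveOperator G) (h0 : HasZeroInf G)
    {ρ : H →L[ℂ] H} (hρ : IsSubState ρ) (hE : traceEnergy G ρ ≠ ⊤) (A B : H →L[ℂ] H) :
    traceNorm (A * ρ * star B) ≤ ENNReal.ofReal
      (opENorm G (traceEnergy G ρ).toReal A * opENorm G (traceEnergy G ρ).toReal B) := by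
  have key := hsSq_mul_sqrt_le hG h0 hρ.nonneg hρ.hsSq_sqrt_le_one ENNReal.toReal_nonneg
    (ENNReal.ofReal_toReal hE).ge
  set S := CFC.sqrt ρ with hS
  have hfac : A * ρ * star B = (A * S) * star (B * S) := by
    have hSS : S * S = ρ := CFC.sqrt_mul_sqrt_self ρ hρ.nonneg
    rw [star_mul, (IsSelfAdjoint.of_nonneg (CFC.sqrt_nonneg ρ)).star_eq, ← hS, ← hSS]
    simp only [mul_assoc]
  have hfin : ∀ C : H →L[ℂ] H, hsSq (C * S) ≠ ⊤ := fun C =>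
    ((key C).trans_lt ENNReal.ofReal_lt_top).ne
  have hle : ∀ C : H →L[ℂ] H,
      √(hsSq (C * S)).toReal ≤ opENorm G (traceEnergy G ρ).toReal C := fun C =>
    (Real.sqrt_le_left (opENorm_nonneg _ _ _)).2
      (ENNReal.toReal_le_of_le_ofReal (sq_nonneg _) (key C))
  rw [hfac]
  refine (traceNorm_mul_le (hfin A) (by rw [hsSq_star]; exact hfin B)).trans ?_
  rw [hsSq_star]
  exact ENNReal.ofReal_le_ofReal
    (mul_le_mul (hle A) (hle B) (Real.sqrt_nonneg _) (opENorm_nonneg _ _ _))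

end Substates

/-! ### 2-positive maps and the Kadison–Schwarz inequality -/

section TwoPositive

variable {H : Type*} [NormedAddCommGroup H] [InnerProductSpace ℂ H] [CompleteSpace H]

/-- A positive operator matrix defines a positive quadratic form. -/
theorem re_sum_inner_nonneg {M : CStarMatrix (Fin 2) (Fin 2) (H →L[ℂ] H)} (hM : 0 ≤ M)
    (x : Fin 2 → H) : 0 ≤ (∑ i, ∑ j, inner ℂ (x i) (M i j (x j))).re := by
  -- Positive matrices are generated additively by the `N*N`, whose quadratic form is a sum of
  -- squared norms.
  rw [StarOrderedRing.nonneg_iff] at hM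
  induction hM using AddSubmonoid.closure_induction with
  | mem M hM =>
    obtain ⟨N, rfl⟩ := hM
    have h : ∑ i, ∑ j, inner ℂ (x i) ((star N * N) i j (x j)) =
        ∑ k, inner ℂ (∑ i, N k i (x i)) (∑ j, N k j (x j)) := by
      have h1 : ∀ i j, inner ℂ (x i) ((star N * N) i j (x j)) =
          ∑ k, inner ℂ (N k i (x i)) (N k j (x j)) := by
        intro i j
        have : (star N * N) i j = ∑ k, star (N k i) * N k j := rfl
        rw [this, sum_apply, inner_sum]
        exact Finset.sum_congr rfl fun k _ => inner_star_right _ _ _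
      simp only [h1, sum_inner, inner_sum]
      simp only [Fin.sum_univ_two]; ring
    rw [h, Complex.re_sum]
    exact Finset.sum_nonneg fun k _ => by rw [re_inner_self]; positivity
  | zero =>
    have : ∀ i j, (0 : CStarMatrix (Fin 2) (Fin 2) (H →L[ℂ] H)) i j = 0 := fun _ _ => rfl
    simp [this]
  | add M N _ _ hM hN =>
    have : ∀ i j, (M + N) i j = M i j + N i j := fun _ _ => rfl
    simp only [this, add_apply, inner_add_right, Finset.sum_add_distrib,
      Complex.add_re]
    exact add_nonneg hM hN

variable {Φ : (H →L[ℂ] H) →ₗ[ℂ] (H →L[ℂ] H)}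

theorem IsTwoPositive.map_matrix_nonneg (hΦ : IsTwoPositive Φ) (A : H →L[ℂ] H) :
    0 ≤ (CStarMatrix.ofMatrix !![Φ (star A * A), Φ (star A); Φ A, Φ 1] :
      CStarMatrix (Fin 2) (Fin 2) (H →L[ℂ] H)) := by
  -- `N*N` has rows `(A*A, A*)` and `(A, 1)`; 2-positivity applies to this matrix.
  set N : CStarMatrix (Fin 2) (Fin 2) (H →L[ℂ] H) := CStarMatrix.ofMatrix !![A, 1; 0, 0] with hN
  have h1 := hΦ _ (star_mul_self_nonneg N)
  convert h1 using 1
  refine CStarMatrix.ext fun i j => ?_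
  have h2 : (star N * N) i j = ∑ k, star (N k i) * N k j := rfl
  have h3 : ∀ k l, N k l = !![A, 1; 0, 0] k l := fun _ _ => rfl
  rw [CStarMatrix.map_apply, h2, Fin.sum_univ_two, h3, h3, h3, h3]
  change !![Φ (star A * A), Φ (star A); Φ A, Φ 1] i j = _
  fin_cases i <;> fin_cases j <;> simp

theorem IsTwoPositive.map_star_mul_self_nonneg (hΦ : IsTwoPositive Φ) (A : H →L[ℂ] H) (φ : H) :
    0 ≤ (inner ℂ φ (Φ (star A * A) φ)).re := by
  have h := re_sum_inner_nonneg (hΦ.map_matrix_nonneg A) ![φ, 0]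
  simp only [Fin.sum_univ_two, Matrix.cons_val_zero, Matrix.cons_val_one, map_zero, inner_zero_left,
    inner_zero_right, add_zero] at h
  exact h

theorem IsTwoPositive.map_star (hΦ : IsTwoPositive Φ) (A : H →L[ℂ] H) :
    Φ (star A) = star (Φ A) := by
  have h := (IsSelfAdjoint.of_nonneg (hΦ.map_matrix_nonneg A)).star_eq
  exact (congrArg (fun M : CStarMatrix (Fin 2) (Fin 2) (H →L[ℂ] H) => M 0 1) h).symm

/-- The Kadison–Schwarz inequality for 2-positive maps. -/
theorem IsTwoPositive.norm_sq_map_le (hΦ : IsTwoPositive Φ) (A : H →L[ℂ] H) (φ : H) :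
    ‖Φ A φ‖ ^ 2 ≤ ‖Φ 1‖ * (inner ℂ φ (Φ (star A * A) φ)).re := by
  set a := (inner ℂ φ (Φ (star A * A) φ)).re with ha
  set ψ := Φ A φ with hψ
  have ha0 : 0 ≤ a := hΦ.map_star_mul_self_nonneg A φ
  -- The matrix is tested on the vector `(φ, -tψ)`. Nonnegativity for all real `t` makes the
  -- discriminant nonpositive, which is the claim multiplied by `4‖ψ‖²`.
  have hq : ∀ t : ℝ, 0 ≤ ‖Φ 1‖ * ‖ψ‖ ^ 2 * (t * t) + (-2 * ‖ψ‖ ^ 2) * t + a := by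
    intro t
    have h := re_sum_inner_nonneg (hΦ.map_matrix_nonneg A) ![φ, ((-t : ℝ) : ℂ) • ψ]
    have h1 : (∑ i, ∑ j, inner ℂ (![φ, ((-t : ℝ) : ℂ) • ψ] i)
        ((CStarMatrix.ofMatrix !![Φ (star A * A), Φ (star A); Φ A, Φ 1] :
          CStarMatrix (Fin 2) (Fin 2) (H →L[ℂ] H)) i j (![φ, ((-t : ℝ) : ℂ) • ψ] j))) =
        inner ℂ φ (Φ (star A * A) φ) + ((-2 * t : ℝ) : ℂ) * inner ℂ ψ ψ +
          ((t * t : ℝ) : ℂ) * inner ℂ ψ (Φ 1 ψ) := by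
      rw [Fin.sum_univ_two, Fin.sum_univ_two, Fin.sum_univ_two]
      change inner ℂ φ (Φ (star A * A) φ) + inner ℂ φ (Φ (star A) (((-t : ℝ) : ℂ) • ψ)) +
        (inner ℂ (((-t : ℝ) : ℂ) • ψ) (Φ A φ) +
          inner ℂ (((-t : ℝ) : ℂ) • ψ) (Φ 1 (((-t : ℝ) : ℂ) • ψ))) = _
      rw [hΦ.map_star, inner_star_right, ← hψ]
      simp only [map_smul, inner_smul_left, inner_smul_right, Complex.conj_ofReal]
      push_cast; ring
    rw [h1, Complex.add_re, Complex.add_re, Complex.re_ofReal_mul, Complex.re_ofReal_mul,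
      re_inner_self] at h
    have h2 : (inner ℂ ψ (Φ 1 ψ)).re ≤ ‖Φ 1‖ * ‖ψ‖ ^ 2 := by
      refine ((Complex.re_le_norm _).trans (norm_inner_le_norm (𝕜 := ℂ) _ _)).trans ?_
      nlinarith [(Φ 1).le_opNorm ψ, norm_nonneg ψ]
    nlinarith [mul_le_mul_of_nonneg_left h2 (mul_self_nonneg t)]
  have hd := discrim_le_zero hq
  rw [discrim] at hd
  rcases (norm_nonneg ψ).eq_or_lt with h | h
  · rw [← h, zero_pow two_ne_zero]
    exact mul_nonneg (norm_nonneg _) ha0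
  · have hp : 0 < ‖ψ‖ ^ 2 := by positivity
    refine le_of_mul_le_mul_left ?_ hp
    nlinarith

end TwoPositive

/-! ### Pure states -/

section RankOne

variable {H : Type*} [NormedAddCommGroup H] [InnerProductSpace ℂ H] [CompleteSpace H]
  {G : H →ₗ.[ℂ] H}

theorem isState_rankOne {φ : H} (hφ : ‖φ‖ = 1) : IsState (InnerProductSpace.rankOne ℂ φ φ) := by
  have hpos : 0 ≤ InnerProductSpace.rankOne ℂ φ φ :=
    (ContinuousLinearMap.nonneg_iff_isPositive _).2 (InnerProductSpace.isPositive_rankOne_self φ)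
  refine ⟨?_, hpos, ?_⟩
  · have h : traceNorm (InnerProductSpace.rankOne ℂ φ φ) = ENNReal.ofReal (‖φ‖ ^ 2) := by
      rw [traceNorm, CFC.abs_of_nonneg _ hpos, ← tsum_ofReal_norm_inner_sq]
      refine tsum_congr fun i => ?_
      rw [InnerProductSpace.rankOne_apply, inner_smul_right, ← inner_conj_symm φ,
        ← Complex.normSq_eq_conj_mul_self, Complex.ofReal_re, Complex.normSq_eq_norm_sq]
    rw [IsTraceClass, h]
    exact ENNReal.ofReal_ne_top
  · have h := trace_rankOne_mul 1 φ φ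
    rw [mul_one] at h
    rw [h]
    change inner ℂ φ φ = 1
    rw [inner_self_eq_norm_sq_to_K, hφ]; simp

theorem traceEnergy_rankOne_le (hG : IsPositiveOperator G) {E : ℝ} (hE : 0 ≤ E) {φ : H}
    (h : energy G φ ≤ ENNReal.ofReal E) :
    traceEnergy G (InnerProductSpace.rankOne ℂ φ φ) ≤ ENNReal.ofReal E := by
  obtain ⟨η, h1, h2⟩ := (energy_le_ofReal_iff hE φ).1 h
  refine iSup_le fun n => ENNReal.ofReal_le_ofReal ?_
  rw [trace_mul_rankOne]
  exact (re_inner_truncOp_le hG n h1).trans h2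

end RankOne

/-! ### The E-norm under maps with a predual -/

section Channels

variable {H : Type*} [NormedAddCommGroup H] [InnerProductSpace ℂ H] [CompleteSpace H]
  {G : H →ₗ.[ℂ] H} {Φ : (H →L[ℂ] H) →ₗ[ℂ] (H →L[ℂ] H)}
  {Φs : {ρ : H →L[ℂ] H // IsTraceClass ρ} → {ρ : H →L[ℂ] H // IsTraceClass ρ}}

theorem IsTwoPositive.inner_map_nonneg (hΦ : IsTwoPositive Φ) {B : H →L[ℂ] H} (hB : 0 ≤ B)
    (φ : H) : 0 ≤ (inner ℂ φ (Φ B φ)).re ∧ (inner ℂ φ (Φ B φ)).im = 0 := by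
  obtain ⟨C, rfl⟩ := CStarAlgebra.nonneg_iff_eq_star_mul_self.1 hB
  refine ⟨hΦ.map_star_mul_self_nonneg C φ, ?_⟩
  have h : star (Φ (star C * C)) = Φ (star C * C) := by rw [← hΦ.map_star, star_mul, star_star]
  rw [← Complex.conj_eq_iff_im, inner_conj_symm]
  conv_lhs => rw [← h]
  exact inner_star_left _ _ _

/-- Duality: pairing the image with rank one projectors gives its quadratic form, which is real and
nonnegative by positivity of `Φ`; pairing it with `1` gives the trace bound from `Φ 1 ≤ 1`. -/
theorem isSubState_predual_rankOne (hΦ : IsTwoPositive Φ) (h1 : Φ 1 ≤ 1) (hp : IsPredual Φ Φs)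
    {φ : H} (hφ : ‖φ‖ = 1) :
    IsSubState (Φs ⟨InnerProductSpace.rankOne ℂ φ φ, (isState_rankOne hφ).traceClass⟩).1 := by
  set ρ : {ρ : H →L[ℂ] H // IsTraceClass ρ} :=
    ⟨InnerProductSpace.rankOne ℂ φ φ, (isState_rankOne hφ).traceClass⟩ with hρ
  have hpair : ∀ B : H →L[ℂ] H, trace (B * (Φs ρ).1) = inner ℂ φ (Φ B φ) := fun B => by
    rw [← hp B ρ, trace_mul_rankOne]
  refine ⟨(Φs ρ).2, ?_, ?_⟩
  · rw [ContinuousLinearMap.nonneg_iff_isPositive, ContinuousLinearMap.isPositive_iff_complex]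
    intro ψ
    have h2 := hpair (InnerProductSpace.rankOne ℂ ψ ψ)
    rw [trace_rankOne_mul] at h2
    obtain ⟨h3, h4⟩ := hΦ.inner_map_nonneg ((ContinuousLinearMap.nonneg_iff_isPositive _).2
      (InnerProductSpace.isPositive_rankOne_self (𝕜 := ℂ) ψ)) φ
    rw [← h2] at h3 h4
    have h5 : inner ℂ ((Φs ρ).1 ψ) ψ = inner ℂ ψ ((Φs ρ).1 ψ) := by
      rw [← inner_conj_symm]; exact Complex.conj_eq_iff_im.2 h4
    rw [h5]
    exact ⟨Complex.ext rfl h4.symm, h3⟩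
  · have h2 := hpair 1
    rw [one_mul] at h2
    rw [h2]
    have h3 := re_inner_nonneg_of_nonneg (sub_nonneg.2 h1) φ
    change 0 ≤ (inner ℂ φ (φ - Φ 1 φ)).re at h3
    rw [inner_sub_right, Complex.sub_re, re_inner_self, hφ] at h3
    linarith

/-- With `σ` the image of the pure state of `φ`, Kadison–Schwarz bounds `‖Φ(A)φ‖²` by `‖Φ(I)‖ Tr
A*Aσ`, and the trace is `‖A√σ‖₂²`, controlled by the E-norm at the output energy. -/
theorem opENorm_map_le (hG : IsPositiveOperator G) (h0 : HasZeroInf G) {E : ℝ} (hE : 0 ≤ E)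
    (hΦ : IsTwoPositive Φ) (h1 : Φ 1 ≤ 1) (hp : IsPredual Φ Φs)
    (hfin : outputEnergy G Φs E ≠ ⊤) (A : H →L[ℂ] H) :
    opENorm G E (Φ A) ≤ √‖Φ 1‖ * opENorm G (outputEnergy G Φs E).toReal A := by
  refine opENorm_le G E _ (mul_nonneg (Real.sqrt_nonneg _) (opENorm_nonneg _ _ _))
    fun φ hφ hφE => ?_
  have hst := isState_rankOne hφ
  have hσ := isSubState_predual_rankOne hΦ h1 hp hφ
  set ρ : {ρ : H →L[ℂ] H // IsTraceClass ρ} :=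
    ⟨InnerProductSpace.rankOne ℂ φ φ, hst.traceClass⟩ with hρ
  have hY : traceEnergy G (Φs ρ).1 ≤ ENNReal.ofReal (outputEnergy G Φs E).toReal := by
    rw [ENNReal.ofReal_toReal hfin]
    exact le_iSup_of_le ρ (le_iSup_of_le hst
      (le_iSup_of_le (traceEnergy_rankOne_le hG hE hφE) le_rfl))
  have hS1 := hσ.hsSq_sqrt_le_one
  have key := hsSq_mul_sqrt_le hG h0 hσ.nonneg hS1 ENNReal.toReal_nonneg hY A
  set S := CFC.sqrt (Φs ρ).1 with hS
  have hSS : S * S = (Φs ρ).1 := CFC.sqrt_mul_sqrt_self _ hσ.nonneg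
  have hStop : hsSq S ≠ ⊤ := (hS1.trans_lt ENNReal.one_lt_top).ne
  have htr : inner ℂ φ (Φ (star A * A) φ) = ((hsSq (A * S)).toReal : ℂ) := by
    rw [← trace_mul_rankOne, hp (star A * A) ρ, ← trace_star_mul_self, star_mul,
      (IsSelfAdjoint.of_nonneg (CFC.sqrt_nonneg (Φs ρ).1)).star_eq, ← hS, ← hSS,
      ← mul_assoc,
      trace_mul_comm (hsSq_mul_ne_top _ hStop) hStop]
    simp only [mul_assoc]
  have h2 := hΦ.norm_sq_map_le A φ
  rw [htr, Complex.ofReal_re] at h2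
  have h3 := ENNReal.toReal_le_of_le_ofReal (sq_nonneg _) key
  refine (pow_le_pow_iff_left₀ (norm_nonneg _)
    (mul_nonneg (Real.sqrt_nonneg _) (opENorm_nonneg _ _ _)) two_ne_zero).1 ?_
  rw [mul_pow, Real.sq_sqrt (norm_nonneg _)]
  exact h2.trans (mul_le_mul_of_nonneg_left h3 (norm_nonneg _))

theorem sqrt_mul_opENorm_le (hG : IsPositiveOperator G) (h0 : HasZeroInf G) {E : ℝ} (hE : 0 < E)
    {Y : ℝ} (hY : 0 ≤ Y) {c : ℝ} (hc : 0 ≤ c) (A : H →L[ℂ] H) :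
    √c * opENorm G Y A ≤ √(c * max 1 (Y / E)) * opENorm G E A := by
  rw [Real.sqrt_mul hc, mul_assoc]
  refine mul_le_mul_of_nonneg_left ?_ (Real.sqrt_nonneg _)
  have hm : (0 : ℝ) ≤ max 1 (Y / E) := zero_le_one.trans (le_max_left _ _)
  refine (pow_le_pow_iff_left₀ (opENorm_nonneg _ _ _)
    (mul_nonneg (Real.sqrt_nonneg _) (opENorm_nonneg _ _ _)) two_ne_zero).1 ?_
  rw [mul_pow, Real.sq_sqrt hm]
  exact opENorm_sq_le_max_mul hG h0 hE hY A

end Channels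

/-! ### Failure of invariance under adjoints -/

section Adjoint

variable {H : Type*} [NormedAddCommGroup H] [InnerProductSpace ℂ H]

theorem exists_orthonormal_pair (hdim : ¬ FiniteDimensional ℂ H) :
    ∃ e f : H, ‖e‖ = 1 ∧ ‖f‖ = 1 ∧ inner ℂ e f = 0 := by
  have hnt : Nontrivial H := by
    by_contra h
    rw [not_nontrivial_iff_subsingleton] at h
    exact hdim inferInstance
  obtain ⟨e, he⟩ := exists_norm_eq H zero_le_one
  have hperp : (Submodule.span ℂ {e})ᗮ ≠ ⊥ := by
    intro h
    rw [Submodule.orthogonal_eq_bot_iff] at h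
    have h1 : FiniteDimensional ℂ (Submodule.span ℂ {e}) := inferInstance
    rw [h] at h1
    exact hdim (Module.finite_def.2 (Module.Finite.iff_fg.1 h1))
  obtain ⟨g, hg, hg0⟩ := Submodule.exists_mem_ne_zero_of_ne_bot hperp
  refine ⟨e, ((‖g‖⁻¹ : ℝ) : ℂ) • g, he, ?_, ?_⟩
  · rw [norm_smul, Complex.norm_real, norm_inv, norm_norm,
      inv_mul_cancel₀ (norm_ne_zero_iff.2 hg0)]
  · rw [inner_smul_right, (Submodule.mem_orthogonal _ _).1 hg e (Submodule.mem_span_singleton_self e),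
      mul_zero]

variable [CompleteSpace H]

/-- An everywhere defined positive operator is a positive operator in the unbounded sense. -/
theorem isPositiveOperator_toPMap {T : H →L[ℂ] H} (hT : 0 ≤ T) :
    IsPositiveOperator (T.toLinearMap.toPMap ⊤) := by
  refine ⟨by simp, ?_, fun φ => re_inner_nonneg_of_nonneg hT φ⟩
  rw [LinearPMap.isSelfAdjoint_def, ContinuousLinearMap.toPMap_adjoint_eq_adjoint_toPMap_of_dense
    T dense_univ]
  congr 2
  exact (IsSelfAdjoint.of_nonneg hT).star_eq

/-- Take `G = 4E (1 - |e⟩⟨e|)` and `A = |f⟩⟨e|` with `e ⊥ f`. The vector `e` costs no energy and `‖A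
e‖ = 1`, while `‖A* φ‖ = |⟨f, φ⟩|` sees only the part of `φ` orthogonal to `e`. -/
theorem exists_opENorm_star_ne (hdim : ¬ FiniteDimensional ℂ H) {E : ℝ} (hE : 0 < E) :
    ∃ G : H →ₗ.[ℂ] H, IsPositiveOperator G ∧ HasZeroInf G ∧
      ∃ A : H →L[ℂ] H, opENorm G E (star A) ≠ opENorm G E A := by
  obtain ⟨e, f, he, hf, hef⟩ := exists_orthonormal_pair hdim
  have hfe : inner ℂ f e = 0 := inner_eq_zero_symm.1 hef
  have hee : inner ℂ e e = (1 : ℂ) := by rw [inner_self_eq_norm_sq_to_K, he]; simp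
  set T : H →L[ℂ] H := (4 * E) • (1 - InnerProductSpace.rankOne ℂ e e) with hT
  have hTx : ∀ x, T x = ((4 * E : ℝ) : ℂ) • (x - inner ℂ e x • e) := fun x => by
    rw [Complex.coe_smul]; rfl
  have hw : ∀ x : H, inner ℂ x (x - inner ℂ e x • e) = ((‖x - inner ℂ e x • e‖ ^ 2 : ℝ) : ℂ) := by
    intro x
    have h1 : inner ℂ (inner ℂ e x • e) (x - inner ℂ e x • e) = 0 := by
      rw [inner_smul_left, inner_sub_right, inner_smul_right, hee]; ring
    have h2 := inner_self_eq_norm_sq_to_K (𝕜 := ℂ) (x - inner ℂ e x • e)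
    rw [inner_sub_left, h1, sub_zero] at h2
    rw [h2]; push_cast; rfl
  have hTin : ∀ x, inner ℂ x (T x) = ((4 * E * ‖x - inner ℂ e x • e‖ ^ 2 : ℝ) : ℂ) := fun x => by
    rw [hTx, inner_smul_right, hw]; push_cast; ring
  have hT0 : 0 ≤ T := by
    rw [ContinuousLinearMap.nonneg_iff_isPositive, ContinuousLinearMap.isPositive_iff_complex]
    intro x
    rw [← inner_conj_symm, hTin, Complex.conj_ofReal]
    exact ⟨rfl, (by positivity : 0 ≤ 4 * E * ‖x - inner ℂ e x • e‖ ^ 2)⟩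
  have hG := isPositiveOperator_toPMap hT0
  have hmem : ∀ x, (x, T x) ∈ (T.toLinearMap.toPMap ⊤).graph := fun x =>
    (LinearPMap.mem_graph_iff _).2 ⟨⟨x, trivial⟩, rfl, rfl⟩
  have hTe : T e = 0 := by rw [hTx, hee, one_smul, sub_self, smul_zero]
  refine ⟨_, hG, ⟨?_, fun b hb => hb ⟨⟨e, trivial⟩, he, ?_⟩⟩,
    InnerProductSpace.rankOne ℂ f e, ne_of_lt ?_⟩
  · rintro r ⟨φ, -, rfl⟩; exact norm_nonneg _
  · change 0 = ‖T e‖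
    rw [hTe, norm_zero]
  · have h1 : 1 ≤ opENorm (T.toLinearMap.toPMap ⊤) E (InnerProductSpace.rankOne ℂ f e) := by
      have := norm_le_opENorm (T.toLinearMap.toPMap ⊤) E (InnerProductSpace.rankOne ℂ f e) he
        (by rw [energy_eq_re_inner hG (hmem e), hTe]; simp)
      rwa [InnerProductSpace.rankOne_apply, hee, one_smul, hf] at this
    have h2 : opENorm (T.toLinearMap.toPMap ⊤) E (star (InnerProductSpace.rankOne ℂ f e)) ≤
        1 / 2 := by
      refine opENorm_le _ _ _ (by norm_num) fun φ hφ hφE => ?_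
      rw [energy_eq_re_inner hG (hmem φ), ENNReal.ofReal_le_ofReal_iff hE.le, hTin,
        Complex.ofReal_re] at hφE
      have h3 : star (InnerProductSpace.rankOne ℂ f e) φ = inner ℂ f φ • e :=
        congrArg (fun S : H →L[ℂ] H => S φ) (InnerProductSpace.adjoint_rankOne (𝕜 := ℂ) f e)
      have h4 : inner ℂ f φ = inner ℂ f (φ - inner ℂ e φ • e) := by
        rw [inner_sub_right, inner_smul_right, hfe, mul_zero, sub_zero]
      have h5 := norm_inner_le_norm (𝕜 := ℂ) f (φ - inner ℂ e φ • e)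
      rw [← h4, hf, one_mul] at h5
      rw [h3, norm_smul, he, mul_one]
      -- The factor `4E` in `G` turns energy at most `E` into a squared norm of at most `1/4`, hence
      -- the bound `1/2 < 1`.
      have h6 : ‖φ - inner ℂ e φ • e‖ ^ 2 ≤ 1 / 4 := by nlinarith
      refine h5.trans (abs_le_of_sq_le_sq' ?_ (by norm_num)).2
      linarith
    linarith

end Adjoint

end OpENorm

theorem proposition4 {H : Type*} [NormedAddCommGroup H] [InnerProductSpace ℂ H] [CompleteSpace H]
    [TopologicalSpace.SeparableSpace H] (hdim : ¬ FiniteDimensional ℂ H) :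
    (∀ G : H →ₗ.[ℂ] H, OpENorm.IsPositiveOperator G → OpENorm.HasZeroInf G →
      ∀ E : ℝ, 0 < E →
        -- A
        (∀ A : H →L[ℂ] H,
          OpENorm.opENorm G E A = OpENorm.opENorm G E (CFC.abs A) ∧
          OpENorm.opENorm G E A ≤ √(OpENorm.opENorm G E (star A * A))) ∧
        -- B
        (∀ A B : H →L[ℂ] H,
          OpENorm.absSpectrumInf A * OpENorm.opENorm G E B ≤ OpENorm.opENorm G E (A * B) ∧
          OpENorm.opENorm G E (A * B) ≤ ‖A‖ * OpENorm.opENorm G E B) ∧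
        -- C
        (∀ A B : H →L[ℂ] H, (∀ φ : H, inner ℂ (A φ) (B φ) = 0) →
          max (OpENorm.opENorm G E A) (OpENorm.opENorm G E B) ≤ OpENorm.opENorm G E (A + B) ∧
          OpENorm.opENorm G E (A + B) ≤
            √(OpENorm.opENorm G E A ^ 2 + OpENorm.opENorm G E B ^ 2)) ∧
        -- D
        (∀ ρ : H →L[ℂ] H, OpENorm.IsSubState ρ → OpENorm.traceEnergy G ρ ≠ ⊤ →
          ∀ A B : H →L[ℂ] H,
            OpENorm.IsTraceClass (A * ρ * star B) ∧
            ‖OpENorm.trace (A * ρ * star B)‖ ≤ (OpENorm.traceNorm (A * ρ * star B)).toReal ∧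
            (OpENorm.traceNorm (A * ρ * star B)).toReal ≤
              OpENorm.opENorm G (OpENorm.traceEnergy G ρ).toReal A *
                OpENorm.opENorm G (OpENorm.traceEnergy G ρ).toReal B) ∧
        -- E
        (∀ (Φ : (H →L[ℂ] H) →ₗ[ℂ] (H →L[ℂ] H))
          (Φs : {ρ : H →L[ℂ] H // OpENorm.IsTraceClass ρ} →
            {ρ : H →L[ℂ] H // OpENorm.IsTraceClass ρ}),
          OpENorm.IsTwoPositive Φ → Φ 1 ≤ 1 → OpENorm.IsPredual Φ Φs →
          OpENorm.outputEnergy G Φs E ≠ ⊤ →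
          ∀ A : H →L[ℂ] H,
            OpENorm.opENorm G E (Φ A) ≤
              √‖Φ 1‖ * OpENorm.opENorm G (OpENorm.outputEnergy G Φs E).toReal A ∧
            √‖Φ 1‖ * OpENorm.opENorm G (OpENorm.outputEnergy G Φs E).toReal A ≤
              √(‖Φ 1‖ * max 1 ((OpENorm.outputEnergy G Φs E).toReal / E)) *
                OpENorm.opENorm G E A)) ∧
    -- A, the E-norm is not invariant under taking adjoints in general
    (∀ E : ℝ, 0 < E → ∃ G : H →ₗ.[ℂ] H, OpENorm.IsPositiveOperator G ∧ OpENorm.HasZeroInf G ∧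
      ∃ A : H →L[ℂ] H, OpENorm.opENorm G E (star A) ≠ OpENorm.opENorm G E A) := by
  refine ⟨fun G hG h0 E hE => ⟨fun A => ⟨(OpENorm.opENorm_abs G E A).symm,
    OpENorm.opENorm_le_sqrt G E A⟩, fun A B => ⟨OpENorm.absSpectrumInf_mul_opENorm_le G E A B,
    OpENorm.opENorm_mul_le G E A B⟩, fun A B h => ⟨OpENorm.max_opENorm_le_opENorm_add G E h,
    OpENorm.opENorm_add_le_sqrt G E h⟩, fun ρ hρ hρE A B => ?_, fun Φ Φs hΦ h1 hp hfin A =>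
    ⟨OpENorm.opENorm_map_le hG h0 hE.le hΦ h1 hp hfin A,
      OpENorm.sqrt_mul_opENorm_le hG h0 hE ENNReal.toReal_nonneg (norm_nonneg _) A⟩⟩,
    fun E hE => OpENorm.exists_opENorm_star_ne hdim hE⟩
  have h := hρ.traceNorm_mul_mul_star_le hG h0 hρE A B
  have htc : OpENorm.IsTraceClass (A * ρ * star B) := (h.trans_lt ENNReal.ofReal_lt_top).ne
  exact ⟨htc, OpENorm.norm_trace_le htc, ENNReal.toReal_le_of_le_ofReal
    (mul_nonneg (OpENorm.opENorm_nonneg _ _ _) (OpENorm.opENorm_nonneg _ _ _)) h⟩
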